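/- **Setting.** Let $p\ge q\ge 0$ be constants with $0<p\le 1$, put $r=q/p$, and let $f_1,f_2$ be fixed real polynomials mapping $[0,1]$ to $[0,1]$. Let $G$ be a graph on $V=V_1\cup V_2$, $|V_1|=|V_2|=n$ (a realization of the stochastic block model $G(2n,p,q)$); for $A\subseteq V$ write $A_i=A\cap V_i$, $\alpha_i=|A_i|/n$. For $f:[0,1]\to[0,1]$, $G$ is *$f$-good* (with constants $C_1,C_2$) if it is connected and non-bipartite, for all $A,S\subseteq V$ and $i\in\{1,2\}$ $$\Bigl|\sum_{v\in S\cap V_i} f\Bigl(\tfrac{\deg_A(v)}{\deg(v)}\Bigr)-|S\cap V_i|\,f\Bigl(\tfrac{|A_i|p+|A_{3-i}|q}{n(p+q)}\Bigr)\Bigr|\le C_1\sqrt{n/p},$$ and for all $A\subseteq V$, $S\in\{A,V\setminus A,V\}$ and $i\in\{1,2\}$ $$\sum_{v\in S\cap V_i} f\Bigl(\tfrac{\deg_A(v)}{\deg(v)}\Bigr)\le |S\cap V_i|\,f\Bigl(\tfrac{|A_i|p+|A_{3-i}|q}{n(p+q)}\Bigr)+C_2|A|\sqrt{\tfrac{\log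 n}{np}} .$$ In the $(f_1,f_2)$-polynomial voting process, if $A$ is the current set of vertices with opinion $1$, then each vertex $v$ independently belongs to the next set $A'$ with probability $f_1(\deg_A(v)/\deg(v))$ if $v\in A$ and $f_2(\deg_A(v)/\deg(v))$ if $v\notin A$; $A^{(0)},A^{(1)},\dots$ is the resulting Markov chain. The induced dynamical system is $H=(H_1,H_2)$ with $$H_i(a_1,a_2)=a_i f_1\Bigl(\tfrac{a_i+ra_{3-i}}{1+r}\Bigr)+(1-a_i)f_2\Bigl(\tfrac{a_i+ra_{3-i}}{1+r}\Bigr).$$ Let $a^*\in\mathbb R^2$ be a fixed point of $H$ whose Jacobian matrix $J$ has linearly independent (possibly complex) eigenvectors $u_1,u_2$ with eigenvalues $\lambda_1,\lambda_2$, and suppose $|\lambda_i|>1$ for some $i$. Put $U=(u_1\,u_2)^{-1}$ and $\beta=U(\alpha-a^*)$; $\beta'$ and $\beta^{(t)}$ denote $\beta$ for $A'$ and $A^{(t)}$. Let $B(a^*,\epsilon)$ be the open ball of $\|\cdot\|_\infty$. Consider the following conditions on $G$, whose positive constants do not depend on $n$: * (A2) $\mathrm{Var}[\alpha_i'\mid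 A]\ge c_0/n$ for $i=1,2$ and all $A\subseteq V$ with $\alpha\in B(a^*,\epsilon_0)$. * (A4) $|\mathbb E[\beta_i'\mid A]|\ge(1+\epsilon_1)|\beta_i|-C/\sqrt n$ for all $A$ with $\|\beta\|_\infty\le\epsilon^*$ and all $i$ with $|\lambda_i|>1$. * (A5) $\Pr[|\beta'_i|\le\epsilon^*\mid A]\ge 1-n^{-c}$ for all $i$ with $|\lambda_i|\le1$ and all $A$ with $|\beta_i|\le\epsilon^*$. **Proposition.** Suppose that one of the following holds. 1. $\epsilon^*$ is so small that every $x\in[0,1]^2$ with $\|U(x-a^*)\|_\infty\le\epsilon^*$ lies in $B(a^*,\epsilon_0)$, and the class of graphs considered consists of all $f_1$-good and $f_2$-good $G$ satisfying (A2), (A4) and (A5). 2. $|\lambda_1|\ne1$ and $|\lambda_2|\neq 1$, and the class considered consists of all $f_1$-good and $f_2$-good $G$ satisfying (A2). Then there are constants $\epsilon',K,\kappa>0$ and $N$, depending only on $p,q,f_1,f_2,a^*,(u_i),(\lambda_i)$ and on the constants in the conditions, such that for every $n\ge N$, every $G$ in the class and every $A^{(0)}\subseteq V$ with $\|\beta^{(0)}\|_\infty\le\epsilon'$,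 with probability at least $1-n^{-\kappa}$ there is a (random) time $\tau\le K\log n$ with (i) $\|\beta^{(\tau)}\|_\infty>\epsilon'$, and (ii) $|\beta_j^{(\tau)}|\le\epsilon'$ for every $j\in\{1,2\}$ with $|\lambda_j|\le1$. -/

import Mathlib

open scoped Polynomial

universe w

noncomputable section

namespace Voting

/-- The `2n` labelled vertices of `G(2n,p,q)`: the vertex `(i, k)` is the `k`-th vertex of
community `V_i`.  The two communities are indexed by `0, 1 : Fin 2`, and `i.rev` is the other one. -/
abbrev Vertex (n : ℕ) : Type := Fin 2 × Fin n

/-- `S ∩ V_i`. -/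
def part {n : ℕ} (S : Finset (Vertex n)) (i : Fin 2) : Finset (Vertex n) :=
  S.filter fun v => v.1 = i

/-- `α_i = |A ∩ V_i| / n`. -/
def density {n : ℕ} (A : Finset (Vertex n)) : Fin 2 → ℝ :=
  fun i => ((part A i).card : ℝ) / n

/-- `deg_A(v)`, the number of neighbours of `v` in `A`. -/
def degIn {n : ℕ} (G : SimpleGraph (Vertex n)) (A : Finset (Vertex n)) (v : Vertex n) : ℕ :=
  {w : Vertex n | G.Adj v w ∧ w ∈ A}.ncard

/-- `deg_A(v) / deg(v)`. -/
def ratio {n : ℕ} (G : SimpleGraph (Vertex n)) (A : Finset (Vertex n)) (v : Vertex n) : ℝ :=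
  (degIn G A v : ℝ) / (degIn G Finset.univ v : ℝ)

/-- `(|A_i| p + |A_{3-i}| q) / (n (p + q))`. -/
def meanRatio {n : ℕ} (p q : ℝ) (A : Finset (Vertex n)) (i : Fin 2) : ℝ :=
  (((part A i).card : ℝ) * p + ((part A i.rev).card : ℝ) * q) / ((n : ℝ) * (p + q))

/-- The graph `G` (a realization of `G(2n,p,q)`) is `f`-good, with constants `C₁, C₂`. -/
structure IsGood {n : ℕ} (f : ℝ → ℝ) (p q C₁ C₂ : ℝ) (G : SimpleGraph (Vertex n)) : Prop where
  connected : G.Connected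
  not_bipartite : ¬ G.IsBipartite
  abs_sub_le : ∀ (A S : Finset (Vertex n)) (i : Fin 2),
    |∑ v ∈ part S i, f (ratio G A v) - ((part S i).card : ℝ) * f (meanRatio p q A i)|
      ≤ C₁ * √((n : ℝ) / p)
  sum_le : ∀ (A S : Finset (Vertex n)) (i : Fin 2), S = A ∨ S = Aᶜ ∨ S = Finset.univ →
    ∑ v ∈ part S i, f (ratio G A v)
      ≤ ((part S i).card : ℝ) * f (meanRatio p q A i)
        + C₂ * (A.card : ℝ) * √(Real.log n / ((n : ℝ) * p))

/-- The probability that `v` holds opinion `1` after one step of the `(f₁,f₂)`-polynomial voting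
process, if `A` is the current set of vertices with opinion `1`. -/
def vertexProb {n : ℕ} (f₁ f₂ : ℝ[X]) (G : SimpleGraph (Vertex n)) (A : Finset (Vertex n))
    (v : Vertex n) : ℝ :=
  if v ∈ A then f₁.eval (ratio G A v) else f₂.eval (ratio G A v)

/-- The transition probability `Pr[A' = B | A]`: the vertices are updated independently. -/
def stepProb {n : ℕ} (f₁ f₂ : ℝ[X]) (G : SimpleGraph (Vertex n)) (A B : Finset (Vertex n)) : ℝ :=
  ∏ v : Vertex n, if v ∈ B then vertexProb f₁ f₂ G A v else 1 - vertexProb f₁ f₂ G A v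

/-- The conditional expectation `E[φ(A') | A]`. -/
def stepExp {n : ℕ} {E : Type*} [AddCommGroup E] [Module ℝ E] (f₁ f₂ : ℝ[X])
    (G : SimpleGraph (Vertex n)) (A : Finset (Vertex n)) (φ : Finset (Vertex n) → E) : E :=
  ∑ B : Finset (Vertex n), stepProb f₁ f₂ G A B • φ B

/-- The conditional variance `Var[φ(A') | A]`. -/
def stepVar {n : ℕ} (f₁ f₂ : ℝ[X]) (G : SimpleGraph (Vertex n)) (A : Finset (Vertex n))
    (φ : Finset (Vertex n) → ℝ) : ℝ :=
  stepExp f₁ f₂ G A fun B => (φ B - stepExp f₁ f₂ G A φ) ^ 2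

open Classical in
/-- The conditional probability `Pr[A' satisfies P | A]`. -/
def stepPr {n : ℕ} (f₁ f₂ : ℝ[X]) (G : SimpleGraph (Vertex n)) (A : Finset (Vertex n))
    (P : Finset (Vertex n) → Prop) : ℝ :=
  ∑ B : Finset (Vertex n), if P B then stepProb f₁ f₂ G A B else 0

/-- `X = (A⁽⁰⁾, A⁽¹⁾, …)` is, on the probability space `(Ω, μ)`, the Markov chain of the
`(f₁,f₂)`-polynomial voting process on `G` started from `A₀`. -/
structure IsVotingProcess {n : ℕ} (f₁ f₂ : ℝ[X]) (G : SimpleGraph (Vertex n))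
    (A₀ : Finset (Vertex n)) {Ω : Type*} [MeasurableSpace Ω] (μ : MeasureTheory.Measure Ω)
    (X : ℕ → Ω → Finset (Vertex n)) : Prop where
  measurable : ∀ (t : ℕ) (B : Finset (Vertex n)), MeasurableSet {ω | X t ω = B}
  law : ∀ (t : ℕ) (B : ℕ → Finset (Vertex n)),
    μ.real {ω | ∀ s ≤ t, X s ω = B s}
      = (if B 0 = A₀ then 1 else 0) * ∏ s ∈ Finset.range t, stepProb f₁ f₂ G (B s) (B (s + 1))

/-- The induced dynamical system `H`, with `r = q / p`. -/
def inducedMap (f₁ f₂ : ℝ[X]) (r : ℝ) (a : Fin 2 → ℝ) : Fin 2 → ℝ := fun i =>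
  a i * f₁.eval ((a i + r * a i.rev) / (1 + r))
    + (1 - a i) * f₂.eval ((a i + r * a i.rev) / (1 + r))

/-- The Jacobian matrix `(∂H_i/∂x_j (a))_{i,j}`. -/
def jacobian (H : (Fin 2 → ℝ) → Fin 2 → ℝ) (a : Fin 2 → ℝ) : Matrix (Fin 2) (Fin 2) ℝ :=
  Matrix.of fun i j => deriv (fun x => H (Function.update a j x) i) (a j)

/-- `U (x - a)` with `U = (u_1 u_2)⁻¹`, the inverse of the matrix whose columns are `u_1, u_2`.
Eigenvectors may be complex, and the norm on `Fin 2 → ℂ` is the maximum of the two moduli. -/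
def eigenCoord (u : Fin 2 → Fin 2 → ℂ) (a x : Fin 2 → ℝ) : Fin 2 → ℂ :=
  (Matrix.of fun k i => u i k)⁻¹.mulVec fun k => ((x k - a k : ℝ) : ℂ)

/-- `β = U (α - a*)` for the configuration `A`. -/
def beta {n : ℕ} (u : Fin 2 → Fin 2 → ℂ) (a : Fin 2 → ℝ) (A : Finset (Vertex n)) : Fin 2 → ℂ :=
  eigenCoord u a (density A)

/-- `Var[α'_i | A] ≥ c / n` whenever `α ∈ B(a*, ε₀)`, the open ball of the maximum norm. -/
def VarianceLowerBound {n : ℕ} (f₁ f₂ : ℝ[X]) (a : Fin 2 → ℝ) (ε₀ c : ℝ)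
    (G : SimpleGraph (Vertex n)) : Prop :=
  ∀ A : Finset (Vertex n), density A ∈ Metric.ball a ε₀ → ∀ i : Fin 2,
    c / n ≤ stepVar f₁ f₂ G A fun B => density B i

/-- `|E[β'_i | A]| ≥ (1 + ε₁) |β_i| - C / √n` whenever `‖β‖ ≤ ε*` and `|λ_i| > 1`. -/
def ExpandingDrift {n : ℕ} (f₁ f₂ : ℝ[X]) (a : Fin 2 → ℝ) (u : Fin 2 → Fin 2 → ℂ)
    (lam : Fin 2 → ℂ) (εs ε₁ C : ℝ) (G : SimpleGraph (Vertex n)) : Prop :=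
  ∀ A : Finset (Vertex n), ‖beta u a A‖ ≤ εs → ∀ i : Fin 2, 1 < ‖lam i‖ →
    (1 + ε₁) * ‖beta u a A i‖ - C / √(n : ℝ) ≤ ‖stepExp f₁ f₂ G A fun B => beta u a B i‖

/-- `Pr[|β'_i| ≤ ε* | A] ≥ 1 - n^{-c}` whenever `|β_i| ≤ ε*`, for each `i` with `|λ_i| ≤ 1`. -/
def NonexpandingStable {n : ℕ} (f₁ f₂ : ℝ[X]) (a : Fin 2 → ℝ) (u : Fin 2 → Fin 2 → ℂ)
    (lam : Fin 2 → ℂ) (εs c : ℝ) (G : SimpleGraph (Vertex n)) : Prop :=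
  ∀ i : Fin 2, ‖lam i‖ ≤ 1 → ∀ A : Finset (Vertex n), ‖beta u a A i‖ ≤ εs →
    1 - (n : ℝ) ^ (-c) ≤ stepPr f₁ f₂ G A fun B => ‖beta u a B i‖ ≤ εs

/-- The process escapes from `a*` within `O(log n)` steps, with high probability, on all large
graphs `G` of the class `𝒢`, the constants being uniform over the class: from any start with
`‖β⁽⁰⁾‖ ≤ ε'`, with probability at least `1 - n^{-c}` there is a time `τ ≤ K log n` with
`‖β⁽τ⁾‖ > ε'` and `|β_j⁽τ⁾| ≤ ε'` for all `j` with `|λ_j| ≤ 1`. -/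
def EscapesWhp (f₁ f₂ : ℝ[X]) (a : Fin 2 → ℝ) (u : Fin 2 → Fin 2 → ℂ) (lam : Fin 2 → ℂ)
    (𝒢 : ∀ n : ℕ, Set (SimpleGraph (Vertex n))) : Prop :=
  ∃ ε' : ℝ, 0 < ε' ∧ ∃ K : ℝ, 0 < K ∧ ∃ c : ℝ, 0 < c ∧ ∃ N : ℕ, ∀ n ≥ N, ∀ G ∈ 𝒢 n,
    ∀ A₀ : Finset (Vertex n), ‖beta u a A₀‖ ≤ ε' →
    ∀ (Ω : Type w) [MeasurableSpace Ω] (μ : MeasureTheory.Measure Ω)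
      [MeasureTheory.IsProbabilityMeasure μ] (X : ℕ → Ω → Finset (Vertex n)),
      IsVotingProcess f₁ f₂ G A₀ μ X →
      1 - (n : ℝ) ^ (-c) ≤ μ.real {ω | ∃ τ : ℕ, (τ : ℝ) ≤ K * Real.log n ∧
        ε' < ‖beta u a (X τ ω)‖ ∧ ∀ j : Fin 2, ‖lam j‖ ≤ 1 → ‖beta u a (X τ ω) j‖ ≤ ε'}

end Voting

end

/-! Measure lengths in units of 1/√n. Near the fixed point one step then multiplies an expanding
quantity `x = √n ξ(β)` by at least some `l > 1`, and contracts a complementary quantity `y = √n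
υ(β)`, up to a weak coupling `δ`, a constant error and noise with bounded second moment. Escape
needs two effects: noise must lift `x` from near 0 to a large constant, and expansion must then
carry it to order √n, which takes O(log n) steps.

One potential handles both. With `z = x - η y`, `escapePotential` is `h / z` when `z ≥ h` and `1 + b
y` otherwise. For `z ≥ h` expansion shrinks it, and a second-moment bound controls the rare large
noise. For `z < h` and `y` large, contraction of `y` shrinks it. For `z < h` and `y` bounded, a
noise jump of probability bounded below halves its leading term. So its conditional mean falls by a
fixed factor `θ < 1` while ‖β‖ ≤ ε (`exists_escapePotential_contraction`). On that region the
potential is at least of order 1/√n, and it starts at O(√n), so the chance of staying there for T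
steps is O(θ^T n), which is polynomially small for a suitable T of order log n. Leaving with a
nonexpanding coordinate too large has probability O(n^{-c}) per step, and a union bound over T steps
finishes (`one_sub_le_measureReal_exit`, `escapesWhp_of_hasEscapeDrift`).

The jump is anticoncentration of a weighted sum of independent Bernoulli variables
(`bernoulli_anticoncentration`, `exists_jump_probability`). The drift is either assumed, or obtained
from goodness of the graph together with the linearization of H in eigencoordinates
(`exists_norm_stepExp_beta_sub_le`). What remains is the choice of ξ and υ: `|β_i|` and 0 under
assumed drift, `‖β‖` and 0 if both eigenvalues expand, `|β_i|` and `|β_j|` at a saddle. -/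

namespace Voting

/-! ### Moments and anticoncentration of weighted sums of independent Bernoulli variables. -/

section ProductBernoulli

variable {V : Type*} [Fintype V] [DecidableEq V]

/-- The probability of `B` when each `v` belongs to the random set independently with
probability `π v`. -/
noncomputable def bernoulliWeight (π : V → ℝ) (B : Finset V) : ℝ :=
  ∏ v, if v ∈ B then π v else 1 - π v

/-- The centred weighted sum `∑ w_v (1[v ∈ B] - π_v)`. -/
noncomputable def centredSum (π w : V → ℝ) (B : Finset V) : ℝ :=
  ∑ v, w v * ((if v ∈ B then 1 else 0) - π v)

/-- The variance of the centred weighted sum. -/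
noncomputable def bernoulliVar (π w : V → ℝ) : ℝ := ∑ v, w v ^ 2 * (π v * (1 - π v))

theorem bernoulliWeight_nonneg {π : V → ℝ} (hπ : ∀ v, π v ∈ Set.Icc (0 : ℝ) 1) (B : Finset V) :
    0 ≤ bernoulliWeight π B := by
  refine Finset.prod_nonneg fun v _ => ?_
  split_ifs
  · exact (hπ v).1
  · linarith [(hπ v).2]

/-- Independence in generating form: expanding the product on the right over subsets gives the left
side. Total mass, means, covariances and exponential moments below are all choices of `g₁` and `g₀`.
-/
theorem sum_bernoulliWeight_mul_prod (π g₁ g₀ : V → ℝ) :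
    ∑ B, bernoulliWeight π B * ∏ v, (if v ∈ B then g₁ v else g₀ v)
      = ∏ v, (π v * g₁ v + (1 - π v) * g₀ v) := by
  rw [Fintype.prod_add]
  refine Finset.sum_congr rfl fun B _ => ?_
  rw [bernoulliWeight, ← Finset.prod_mul_distrib, ← Finset.prod_mul_prod_compl B]
  congr 1
  · exact Finset.prod_congr rfl fun v hv => by simp [hv]
  · exact Finset.prod_congr rfl fun v hv => by simp [Finset.mem_compl.1 hv]

theorem sum_bernoulliWeight (π : V → ℝ) : ∑ B, bernoulliWeight π B = 1 := by
  simpa using sum_bernoulliWeight_mul_prod π (fun _ => 1) (fun _ => 1)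

theorem sum_bernoulliWeight_mul_indicator (π : V → ℝ) (u : V) :
    ∑ B, bernoulliWeight π B * (if u ∈ B then 1 else 0) = π u := by
  have h := sum_bernoulliWeight_mul_prod π (fun _ => 1) (fun v => if v = u then 0 else 1)
  have e : ∀ B : Finset V, (∏ v, if v ∈ B then (1 : ℝ) else if v = u then 0 else 1)
      = if u ∈ B then 1 else 0 := by
    intro B
    rw [Finset.prod_eq_single u (fun v _ hv => by simp [hv]) (by simp)]
    simp
  simp only [e] at h
  rw [h, Finset.prod_eq_single u (fun v _ hv => by simp [hv]) (by simp)]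
  simp

theorem sum_bernoulliWeight_mul_centred_mul_centred (π : V → ℝ) (u v : V) :
    ∑ B, bernoulliWeight π B *
        (((if u ∈ B then 1 else 0) - π u) * ((if v ∈ B then 1 else 0) - π v))
      = if u = v then π v * (1 - π v) else 0 := by
  have e : ∀ (B : Finset V) (x : V),
      ((if x ∈ B then (1 : ℝ) else 0) - π x)
        = ∏ y, if y ∈ B then (if y = x then 1 - π y else 1) else (if y = x then - π y else 1) := by
    intro B x
    rw [Finset.prod_eq_single x (fun y _ hy => by simp [hy]) (by simp)]
    by_cases hx : x ∈ B <;> simp [hx]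
  have h := sum_bernoulliWeight_mul_prod π
    (fun y => (if y = u then 1 - π y else 1) * (if y = v then 1 - π y else 1))
    (fun y => (if y = u then - π y else 1) * (if y = v then - π y else 1))
  -- The centred indicators are written as products over all vertices with trivial factors away from
  -- `u` and `v`, so that the generating identity applies.
  have e2 : ∀ B : Finset V, ((if u ∈ B then (1 : ℝ) else 0) - π u) * ((if v ∈ B then 1 else 0) - π v)
      = ∏ y, if y ∈ B then (if y = u then 1 - π y else 1) * (if y = v then 1 - π y else 1)
        else (if y = u then - π y else 1) * (if y = v then - π y else 1) := by
    intro B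
    rw [e, e, ← Finset.prod_mul_distrib]
    refine Finset.prod_congr rfl fun y _ => ?_
    by_cases hy : y ∈ B <;> simp [hy]
  simp only [e2]
  rw [h]
  split_ifs with huv
  · subst huv
    rw [Finset.prod_eq_single u (fun y _ hy => by simp [hy]) (by simp)]
    simp only [if_true]
    ring
  · refine Finset.prod_eq_zero (Finset.mem_univ u) ?_
    simp [huv]
    ring

theorem sum_bernoulliWeight_mul_centredSum_sq (π w : V → ℝ) :
    ∑ B, bernoulliWeight π B * centredSum π w B ^ 2 = bernoulliVar π w := by
  have e : ∀ B, bernoulliWeight π B * centredSum π w B ^ 2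
      = ∑ u, ∑ v, w u * w v * (bernoulliWeight π B *
        (((if u ∈ B then 1 else 0) - π u) * ((if v ∈ B then 1 else 0) - π v))) := by
    intro B
    rw [centredSum, sq, Finset.sum_mul_sum, Finset.mul_sum]
    refine Finset.sum_congr rfl fun u _ => ?_
    rw [Finset.mul_sum]
    exact Finset.sum_congr rfl fun v _ => by ring
  simp only [e]
  rw [Finset.sum_comm, bernoulliVar]
  refine Finset.sum_congr rfl fun u _ => ?_
  rw [Finset.sum_comm]
  simp only [← Finset.mul_sum, sum_bernoulliWeight_mul_centred_mul_centred]
  simp [sq, mul_assoc]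

theorem sum_bernoulliWeight_mul_exp (π w : V → ℝ) (t : ℝ) :
    ∑ B, bernoulliWeight π B * Real.exp (t * centredSum π w B)
      = ∏ v, (π v * Real.exp (t * w v * (1 - π v))
          + (1 - π v) * Real.exp (t * w v * (- π v))) := by
  rw [← sum_bernoulliWeight_mul_prod]
  refine Finset.sum_congr rfl fun B _ => ?_
  rw [centredSum, Finset.mul_sum, Real.exp_sum]
  congr 1
  refine Finset.prod_congr rfl fun v _ => ?_
  split_ifs
  · ring_nf
  · ring_nf

theorem one_add_add_sq_div_le_exp {y : ℝ} (hy : |y| ≤ 1) : 1 + y + y ^ 2 / 4 ≤ Real.exp y := by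
  have h := Real.exp_bound hy (n := 3) (by norm_num)
  norm_num [Finset.sum_range_succ, Nat.factorial] at h
  have h1 := (abs_le.1 h).1
  have h2 : |y| ^ 3 ≤ y ^ 2 := by
    have : |y| ^ 3 = y ^ 2 * |y| := by rw [pow_succ, sq_abs]
    rw [this]
    nlinarith [sq_nonneg y]
  nlinarith [sq_nonneg y]

/-- The linear terms cancel and the quadratic ones add up to the variance, since `x(1-x)² + (1-x)x²
= x(1-x)`. The lower bound uses `1 + y + y²/4 ≤ exp y`, the upper one `exp y ≤ 1 + y + y²`, both for
`|y| ≤ 1`. -/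
theorem bernoulli_exp_bounds {x s : ℝ} (hx : x ∈ Set.Icc (0 : ℝ) 1) (hs : |s| ≤ 1) :
    Real.exp (s ^ 2 * (x * (1 - x)) / 8)
        ≤ x * Real.exp (s * (1 - x)) + (1 - x) * Real.exp (s * (-x)) ∧
      x * Real.exp (s * (1 - x)) + (1 - x) * Real.exp (s * (-x))
        ≤ Real.exp (s ^ 2 * (x * (1 - x))) := by
  obtain ⟨hx0, hx1⟩ := hx
  have hx1' : 0 ≤ 1 - x := by linarith
  have b1 : |s * (1 - x)| ≤ 1 := by
    rw [abs_mul, abs_of_nonneg hx1']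
    nlinarith [abs_nonneg s]
  have b2 : |s * (-x)| ≤ 1 := by
    rw [abs_mul, abs_neg, abs_of_nonneg hx0]
    nlinarith [abs_nonneg s]
  have hv : 0 ≤ x * (1 - x) := mul_nonneg hx0 hx1'
  have hs2 : s ^ 2 ≤ 1 := by rw [← sq_abs]; nlinarith [abs_nonneg s]
  constructor
  · have l1 := mul_le_mul_of_nonneg_left (one_add_add_sq_div_le_exp b1) hx0
    have l2 := mul_le_mul_of_nonneg_left (one_add_add_sq_div_le_exp b2) hx1'
    set y := s ^ 2 * (x * (1 - x)) with hy
    have hy0 : 0 ≤ y := by positivity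
    have hy1 : y ≤ 1 := by nlinarith
    have hl : 1 + y / 4 ≤ x * Real.exp (s * (1 - x)) + (1 - x) * Real.exp (s * (-x)) := by
      refine le_trans (le_of_eq ?_) (add_le_add l1 l2)
      rw [hy]; ring
    refine le_trans ?_ hl
    have h := Real.abs_exp_sub_one_sub_id_le (x := y / 8) (by rw [abs_of_nonneg] <;> linarith)
    nlinarith [(abs_le.1 h).2]
  · have u1 := (abs_le.1 (Real.abs_exp_sub_one_sub_id_le b1)).2
    have u2 := (abs_le.1 (Real.abs_exp_sub_one_sub_id_le b2)).2
    have l1 : x * Real.exp (s * (1 - x)) ≤ x * (1 + s * (1 - x) + (s * (1 - x)) ^ 2) :=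
      mul_le_mul_of_nonneg_left (by linarith) hx0
    have l2 : (1 - x) * Real.exp (s * (-x)) ≤ (1 - x) * (1 + s * (-x) + (s * (-x)) ^ 2) :=
      mul_le_mul_of_nonneg_left (by linarith) hx1'
    refine le_trans (add_le_add l1 l2) ?_
    refine le_trans (le_of_eq ?_) (Real.add_one_le_exp _)
    ring

theorem exp_le_sum_bernoulliWeight_mul_exp {π w : V → ℝ} (hπ : ∀ v, π v ∈ Set.Icc (0 : ℝ) 1)
    {t : ℝ} (ht : ∀ v, |t * w v| ≤ 1) :
    Real.exp (t ^ 2 * bernoulliVar π w / 8)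
      ≤ ∑ B, bernoulliWeight π B * Real.exp (t * centredSum π w B) := by
  rw [sum_bernoulliWeight_mul_exp, bernoulliVar, Finset.mul_sum, Finset.sum_div, Real.exp_sum]
  refine Finset.prod_le_prod (fun v _ => (Real.exp_pos _).le) fun v _ => ?_
  refine le_trans (le_of_eq ?_) (bernoulli_exp_bounds (hπ v) (ht v)).1
  congr 1; ring

theorem sum_bernoulliWeight_mul_exp_le {π w : V → ℝ} (hπ : ∀ v, π v ∈ Set.Icc (0 : ℝ) 1)
    {t : ℝ} (ht : ∀ v, |t * w v| ≤ 1) :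
    ∑ B, bernoulliWeight π B * Real.exp (t * centredSum π w B)
      ≤ Real.exp (t ^ 2 * bernoulliVar π w) := by
  rw [sum_bernoulliWeight_mul_exp, bernoulliVar, Finset.mul_sum, Real.exp_sum]
  refine Finset.prod_le_prod (fun v _ => ?_) fun v _ => ?_
  · have := (hπ v).1
    have : 0 ≤ 1 - π v := by linarith [(hπ v).2]
    positivity
  · refine le_trans (bernoulli_exp_bounds (hπ v) (ht v)).2 (le_of_eq ?_)
    congr 1; ring

open Classical in
/-- A weighted sum of independent Bernoulli variables with small weights exceeds its mean by `H`
with a probability bounded below in terms of `H` and two-sided bounds on the variance. -/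
theorem bernoulli_anticoncentration {π w : V → ℝ} (hπ : ∀ v, π v ∈ Set.Icc (0 : ℝ) 1)
    {t s S H : ℝ} (hH : 0 ≤ H) (ht1 : 1 ≤ t) (hts : 8 * (H + 1) ≤ t * s)
    (hs : s ≤ bernoulliVar π w) (hS : bernoulliVar π w ≤ S)
    (ht : ∀ v, |2 * t * w v| ≤ 1) :
    Real.exp (-(4 * t ^ 2 * S)) ≤
      ∑ B, if H ≤ centredSum π w B then bernoulliWeight π B else 0 := by
  set P := ∑ B, if H ≤ centredSum π w B then bernoulliWeight π B else 0 with hP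
  have hw := bernoulliWeight_nonneg hπ
  have ht' : ∀ v, |t * w v| ≤ 1 := by
    intro v
    have := ht v
    rw [mul_assoc, abs_mul, abs_two] at this
    linarith [abs_nonneg (t * w v)]
  have h1 := exp_le_sum_bernoulliWeight_mul_exp hπ ht'
  have h2 := sum_bernoulliWeight_mul_exp_le hπ ht
  -- Paley–Zygmund for `exp (t Z)`, with Z the centred sum. Its mean is at least `2 exp (t H)`, and
  -- the event `Z < H` contributes at most `exp (t H)`; hence `Q ≥ 1`. Cauchy–Schwarz then bounds
  -- `Q²` by the exponential moment at `2t` times the probability sought.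
  set Q := ∑ B, if H ≤ centredSum π w B then
    bernoulliWeight π B * Real.exp (t * centredSum π w B) else 0 with hQ
  have hsplit : ∑ B, bernoulliWeight π B * Real.exp (t * centredSum π w B)
      ≤ Real.exp (t * H) + Q := by
    have : Real.exp (t * H) = ∑ B, bernoulliWeight π B * Real.exp (t * H) := by
      rw [← Finset.sum_mul, sum_bernoulliWeight, one_mul]
    rw [this, hQ, ← Finset.sum_add_distrib]
    refine Finset.sum_le_sum fun B _ => ?_
    split_ifs with h
    · have := mul_nonneg (hw B) (Real.exp_pos (t * H)).le
      linarith
    · rw [add_zero]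
      refine mul_le_mul_of_nonneg_left (Real.exp_le_exp.2 ?_) (hw B)
      exact mul_le_mul_of_nonneg_left (le_of_not_ge h) (by linarith)
  have hbig : Real.exp (t * H) + Real.exp (t * H) ≤ Real.exp (t ^ 2 * bernoulliVar π w / 8) := by
    have e1 : t * H + 1 ≤ t ^ 2 * bernoulliVar π w / 8 := by
      have : t * (8 * (H + 1)) ≤ t * (t * bernoulliVar π w) :=
        mul_le_mul_of_nonneg_left (hts.trans (mul_le_mul_of_nonneg_left hs (by linarith)))
          (by linarith)
      nlinarith
    refine le_trans ?_ (Real.exp_le_exp.2 e1)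
    rw [Real.exp_add]
    have := Real.add_one_le_exp 1
    nlinarith [Real.exp_pos (t * H)]
  have hQ1 : 1 ≤ Q := by
    have : 1 ≤ Real.exp (t * H) := Real.one_le_exp (by positivity)
    linarith
  have hCS : Q ^ 2 ≤ (∑ B, bernoulliWeight π B * Real.exp (2 * t * centredSum π w B)) * P := by
    refine Finset.sum_sq_le_sum_mul_sum_of_sq_le_mul _ (fun B _ => ?_) (fun B _ => ?_)
      (fun B _ => ?_)
    · exact mul_nonneg (hw B) (Real.exp_pos _).le
    · split_ifs
      · exact hw B
      · exact le_rfl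
    · refine le_of_eq ?_
      split_ifs
      · have : Real.exp (2 * t * centredSum π w B) = Real.exp (t * centredSum π w B) ^ 2 := by
          rw [← Real.exp_nat_mul]; push_cast; ring_nf
        rw [this]; ring
      · ring
  have hP0 : 0 ≤ P := Finset.sum_nonneg fun B _ => by split_ifs; exacts [hw B, le_rfl]
  have h3 : Real.exp ((2 * t) ^ 2 * bernoulliVar π w) ≤ Real.exp (4 * t ^ 2 * S) := by
    refine Real.exp_le_exp.2 ?_
    nlinarith [sq_nonneg t]
  have h4 : 1 ≤ Real.exp (4 * t ^ 2 * S) * P :=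
    calc (1 : ℝ) ≤ Q ^ 2 := by nlinarith
      _ ≤ _ := hCS
      _ ≤ _ := mul_le_mul_of_nonneg_right (h2.trans h3) hP0
  rw [Real.exp_neg, inv_le_iff_one_le_mul₀ (Real.exp_pos _), mul_comm]
  exact h4

end ProductBernoulli

/-! ### A potential with multiplicative decrease for an expanding and a contracting coordinate. -/

section Potential

/-- A potential that decreases in mean, for a process whose first coordinate `x` expands and whose
second coordinate `y` contracts. -/
noncomputable def escapePotential (h b η x y : ℝ) : ℝ :=
  if h ≤ x - η * y then h / (x - η * y) else 1 + b * y

theorem escapePotential_le {h b η x y : ℝ} (hh : 0 < h) (hb : 0 ≤ b) (hy : 0 ≤ y) :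
    escapePotential h b η x y ≤ 1 + b * y := by
  rw [escapePotential]
  split_ifs with hz
  · have : h / (x - η * y) ≤ 1 := (div_le_one (by linarith)).2 hz
    nlinarith [mul_nonneg hb hy]
  · exact le_rfl

theorem escapePotential_nonneg {h b η x y : ℝ} (hh : 0 < h) (hb : 0 ≤ b) (hy : 0 ≤ y) :
    0 ≤ escapePotential h b η x y := by
  rw [escapePotential]
  split_ifs with hz
  · exact div_nonneg hh.le (by linarith)
  · positivity

/-- Keeps the potential away from 0 as long as `x` is bounded; this is the lower bound used in
Markov's inequality. -/
theorem div_add_le_escapePotential {h b η x y : ℝ} (hh : 0 < h) (hb : 0 ≤ b) (hη : 0 ≤ η)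
    (hx : 0 ≤ x) (hy : 0 ≤ y) : h / (h + x) ≤ escapePotential h b η x y := by
  rw [escapePotential]
  split_ifs with hz
  · exact div_le_div_of_nonneg_left hh.le (by linarith) (by nlinarith [mul_nonneg hη hy])
  · have : h / (h + x) ≤ 1 := (div_le_one (by linarith)).2 (by linarith)
    nlinarith [mul_nonneg hb hy]

theorem escapePotential_le_half {h b η x y : ℝ} (hh : 0 < h) (hz : 2 * h ≤ x - η * y) :
    escapePotential h b η x y ≤ 1 / 2 := by
  rw [escapePotential, if_pos (by linarith), div_le_div_iff₀ (by linarith) (by norm_num)]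
  linarith

variable {S : Type*} [Fintype S] {P : S → ℝ} {x' y' W : S → ℝ} {x y : ℝ}

/-- Moderate noise. Of the surplus `8κ x`, one `κ x` pays for the coupling, one for the two errors
`C`, and two for the noise in both coordinates. The remaining four make `z` grow by the factor `1 +
4κ`; the condition `δ ≤ η (1 - ρ)` keeps the `y` terms harmless. -/
theorem escapePotential_le_of_le {x y x' y' W l ρ δ C κ h b η : ℝ}
    (hx : 0 ≤ x) (hy : 0 ≤ y) (hW : 0 ≤ W)
    (hκ : 0 < κ) (hl : l = 1 + 8 * κ) (hC : 0 ≤ C) (hh : 1 ≤ h)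
    (hCh' : 2 * C ≤ κ * h) (hη : 0 < η) (hη1 : η ≤ 1)
    (hδ : 0 < δ) (hδκ : δ ≤ κ) (hδη : δ ≤ η * (1 - ρ))
    (hdx : l * x - δ * y - C - W ≤ x') (hdy : y' ≤ ρ * y + δ * x + C + W)
    (hz : h ≤ x - η * y) (hg : W ≤ κ * x) :
    escapePotential h b η x' y' ≤ h / ((1 + 4 * κ) * (x - η * y)) := by
  have hηy : 0 ≤ η * y := mul_nonneg hη.le hy
  have hz0 : 0 < x - η * y := by linarith
  have hxh : h ≤ x := by linarith
  have hyy : η * y' ≤ η * (ρ * y + δ * x + C + W) := mul_le_mul_of_nonneg_left hdy hη.le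
  have hz' : (1 + 4 * κ) * (x - η * y) ≤ x' - η * y' := by
    have a1 : η * (δ * x) ≤ κ * x := by
      have h1 : η * δ ≤ 1 * κ := mul_le_mul hη1 hδκ hδ.le (by norm_num)
      have h2 := mul_le_mul_of_nonneg_right h1 hx
      linarith
    have a2 : δ * y ≤ η * (1 - ρ) * y := mul_le_mul_of_nonneg_right hδη hy
    have a3 : η * (C + W) ≤ 1 * (C + W) := mul_le_mul_of_nonneg_right hη1 (by positivity)
    have a4 : κ * h ≤ κ * x := mul_le_mul_of_nonneg_left hxh hκ.le
    have a5 : 0 ≤ κ * (η * y) := by positivity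
    subst hl
    linarith
  have hz'' : h ≤ x' - η * y' := by
    have : 0 ≤ κ * (x - η * y) := by positivity
    linarith
  rw [escapePotential, if_pos hz'']
  exact div_le_div_of_nonneg_left (by linarith : (0 : ℝ) ≤ h) (by positivity) hz'

/-- Large noise. The crude bound `1 + b y' ≤ 4x + W` is charged to `W²` by means of `W > κ x`, so
that only the second moment of the noise is needed. -/
theorem escapePotential_le_of_lt {x y x' y' W ρ δ C κ h b η : ℝ}
    (hy : 0 ≤ y) (hy' : 0 ≤ y') (hW : 0 ≤ W)
    (hρ1 : ρ < 1) (hκ : 0 < κ) (hκ1 : κ ≤ 1 / 8) (hC : 0 ≤ C) (hh : 1 ≤ h) (hCh : C ≤ h)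
    (hη : 0 < η) (hη1 : η ≤ 1) (hδ : 0 < δ) (hδκ : δ ≤ κ) (hb : 0 ≤ b) (hbη : b ≤ η)
    (hdy : y' ≤ ρ * y + δ * x + C + W)
    (hz : h ≤ x - η * y) (hg : κ * x < W) :
    escapePotential h b η x' y' ≤ 5 / (κ ^ 2 * x) * W ^ 2 := by
  have hηy : 0 ≤ η * y := mul_nonneg hη.le hy
  have hxh : h ≤ x := by linarith
  have hx0 : 0 < x := by linarith
  refine (escapePotential_le (by linarith) hb hy').trans ?_
  have b1 : b ≤ 1 := hbη.trans hη1
  have c1 : b * y' ≤ b * (ρ * y + δ * x + C + W) := mul_le_mul_of_nonneg_left hdy hb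
  have c2 : b * (ρ * y) ≤ x := by
    have h1 : ρ * y ≤ 1 * y := mul_le_mul_of_nonneg_right hρ1.le hy
    have h2 : b * (ρ * y) ≤ b * y := mul_le_mul_of_nonneg_left (by linarith) hb
    have h3 := mul_le_mul_of_nonneg_right hbη hy
    linarith
  have c3 : b * (δ * x + C + W) ≤ 1 * (δ * x + C + W) :=
    mul_le_mul_of_nonneg_right b1 (by positivity)
  have c4 : δ * x ≤ 1 * x := mul_le_mul_of_nonneg_right (by linarith) hx0.le
  have c5 : 1 + b * y' ≤ 4 * x + W := by linarith
  have c6 : (4 * x + W) * (κ ^ 2 * x) ≤ 5 * W ^ 2 := by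
    have e1 : κ * x * (κ * x) ≤ W * W := mul_self_le_mul_self (by positivity) hg.le
    have e2 : κ * x * W ≤ W * W := mul_le_mul_of_nonneg_right hg.le hW
    have e3 : κ * (κ * x * W) ≤ 1 * (κ * x * W) :=
      mul_le_mul_of_nonneg_right (by linarith) (by positivity)
    have e4 : (4 * x + W) * (κ ^ 2 * x) = 4 * (κ * x * (κ * x)) + κ * (κ * x * W) := by ring
    rw [e4, sq]
    linarith
  refine c5.trans ?_
  rw [div_mul_eq_mul_div, le_div_iff₀ (by positivity)]
  exact c6

theorem sum_mul_escapePotential_le_of_expanding (hP : ∀ s, 0 ≤ P s) (hP1 : ∑ s, P s = 1)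
    (hx : 0 ≤ x) (hy : 0 ≤ y) (hy' : ∀ s, 0 ≤ y' s) (hW : ∀ s, 0 ≤ W s)
    {l ρ δ C Q κ h b η : ℝ} (hρ1 : ρ < 1) (hκ : 0 < κ) (hκ1 : κ ≤ 1 / 8)
    (hl : l = 1 + 8 * κ) (hC : 0 ≤ C) (hh : 1 ≤ h) (hCh : C ≤ h) (hCh' : 2 * C ≤ κ * h)
    (hQh : 5 * Q ≤ κ ^ 3 * h) (hη : 0 < η) (hη1 : η ≤ 1)
    (hδ : 0 < δ) (hδκ : δ ≤ κ) (hδη : δ ≤ η * (1 - ρ)) (hb : 0 ≤ b) (hbη : b ≤ η)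
    (hdx : ∀ s, l * x - δ * y - C - W s ≤ x' s) (hdy : ∀ s, y' s ≤ ρ * y + δ * x + C + W s)
    (hWV : ∑ s, P s * W s ^ 2 ≤ Q) (hz : h ≤ x - η * y) :
    ∑ s, P s * escapePotential h b η (x' s) (y' s)
      ≤ (1 - κ) * escapePotential h b η x y := by
  have hηy : 0 ≤ η * y := mul_nonneg hη.le hy
  have hxh : h ≤ x := by linarith
  have hx0 : 0 < x := by linarith
  have hz0 : 0 < x - η * y := by linarith
  have hpt : ∀ s, escapePotential h b η (x' s) (y' s)
      ≤ h / ((1 + 4 * κ) * (x - η * y)) + 5 / (κ ^ 2 * x) * W s ^ 2 := by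
    intro s
    have t1 : 0 ≤ h / ((1 + 4 * κ) * (x - η * y)) := by positivity
    have t2 : 0 ≤ 5 / (κ ^ 2 * x) * W s ^ 2 := by positivity
    by_cases hg : W s ≤ κ * x
    · have := escapePotential_le_of_le (b := b) hx hy (hW s) hκ hl hC hh hCh' hη hη1 hδ hδκ hδη
        (hdx s) (hdy s) hz hg
      linarith
    · have := escapePotential_le_of_lt (x' := x' s) hy (hy' s) (hW s) hρ1 hκ hκ1 hC hh hCh hη hη1 hδ
        hδκ hb hbη (hdy s) hz (not_le.1 hg)
      linarith
  have hsum : ∑ s, P s * escapePotential h b η (x' s) (y' s)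
      ≤ h / ((1 + 4 * κ) * (x - η * y)) + 5 / (κ ^ 2 * x) * Q := by
    calc ∑ s, P s * escapePotential h b η (x' s) (y' s)
        ≤ ∑ s, P s * (h / ((1 + 4 * κ) * (x - η * y)) + 5 / (κ ^ 2 * x) * W s ^ 2) :=
          Finset.sum_le_sum fun s _ => mul_le_mul_of_nonneg_left (hpt s) (hP s)
      _ = h / ((1 + 4 * κ) * (x - η * y)) + 5 / (κ ^ 2 * x) * ∑ s, P s * W s ^ 2 := by
          simp only [mul_add, Finset.sum_add_distrib, ← Finset.sum_mul, hP1, one_mul,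
            Finset.mul_sum]
          congr 1
          exact Finset.sum_congr rfl fun s _ => by ring
      _ ≤ _ := by gcongr
  refine hsum.trans ?_
  rw [escapePotential, if_pos hz]
  -- Moderate noise gains `2κ`; large noise gives back at most `κ`, because `h` is large compared
  -- with `Q / κ³`.
  have d1 : h / ((1 + 4 * κ) * (x - η * y)) ≤ (1 - 2 * κ) * (h / (x - η * y)) := by
    rw [mul_div_assoc', div_le_div_iff₀ (by positivity) hz0]
    have : 1 ≤ (1 - 2 * κ) * (1 + 4 * κ) := by nlinarith
    have h0 : 0 ≤ h * (x - η * y) := by positivity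
    nlinarith
  have d2 : 5 / (κ ^ 2 * x) * Q ≤ κ * (h / (x - η * y)) := by
    have : 5 / (κ ^ 2 * x) * Q ≤ κ * (h / x) := by
      rw [div_mul_eq_mul_div, mul_div_assoc', div_le_div_iff₀ (by positivity) hx0]
      nlinarith
    refine this.trans (mul_le_mul_of_nonneg_left ?_ hκ.le)
    exact div_le_div_of_nonneg_left (by linarith) hz0 (by linarith)
  linarith

-- Here `x < h + η y`, so the coupling adds to `y'` at most a constant plus `(1 - ρ)/2 · y`, and `y`
-- still contracts with factor `(1 + ρ)/2`. Beyond the threshold `Y` this contraction suffices.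
-- Below it `b y` is negligible, and the jump supplies the decrease.
open Classical in
theorem sum_mul_escapePotential_le_of_contracting (hP : ∀ s, 0 ≤ P s) (hP1 : ∑ s, P s = 1)
    (hy : 0 ≤ y) (hy' : ∀ s, 0 ≤ y' s)
    {ρ δ C Q h b η ε c M C₂ Y : ℝ}
    (hh : 1 ≤ h) (hη : 0 < η) (hη1 : η ≤ 1)
    (hδ : 0 < δ) (hδh : δ * h ≤ 1) (hδη : δ ≤ (1 - ρ) / 2) (hb : 0 < b)
    (hC₂ : C₂ = C + 2 + Q) (hY : (1 - ρ) * Y = 8 * C₂)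
    (hηY : η * (Y + C + 1 + M) ≤ 1) (hbY : b * (Y + C₂) ≤ c / 4)
    (hε : 0 < ε) (hεb : ε ≤ b * C₂) (hερ : ε ≤ (1 - ρ) / 4) (hεc : ε ≤ c / 4)
    (hε1 : ε ≤ 1) (hdy : ∀ s, y' s ≤ ρ * y + δ * x + C + W s)
    (hWV : ∑ s, P s * W s ^ 2 ≤ Q)
    (hjump : c ≤ ∑ s, if 2 * h + 1 ≤ x' s ∧ W s ≤ M then P s else 0)
    (hz : x - η * y < h) :
    ∑ s, P s * escapePotential h b η (x' s) (y' s)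
      ≤ (1 - ε) * escapePotential h b η x y := by
  have hdy1 : ∀ s, y' s ≤ (1 + ρ) / 2 * y + (C + 1) + W s := by
    intro s
    have e1 : δ * x ≤ δ * (h + η * y) := mul_le_mul_of_nonneg_left (by linarith) hδ.le
    have e2 : δ * (η * y) ≤ (1 - ρ) / 2 * y := by
      have : η * y ≤ 1 * y := mul_le_mul_of_nonneg_right hη1 hy
      have h1 : δ * (η * y) ≤ δ * y := mul_le_mul_of_nonneg_left (by linarith) hδ.le
      exact h1.trans (mul_le_mul_of_nonneg_right hδη hy)
    have := hdy s
    nlinarith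
  have hEW : ∑ s, P s * W s ≤ 1 + Q := by
    calc ∑ s, P s * W s ≤ ∑ s, (P s + P s * W s ^ 2) := by
          refine Finset.sum_le_sum fun s _ => ?_
          rw [← mul_one_add]
          exact mul_le_mul_of_nonneg_left (by nlinarith [sq_nonneg (W s - 1)]) (hP s)
      _ ≤ 1 + Q := by rw [Finset.sum_add_distrib, hP1]; linarith
  have hEy : ∑ s, P s * y' s ≤ (1 + ρ) / 2 * y + C₂ := by
    calc ∑ s, P s * y' s ≤ ∑ s, P s * ((1 + ρ) / 2 * y + (C + 1) + W s) :=
          Finset.sum_le_sum fun s _ => mul_le_mul_of_nonneg_left (hdy1 s) (hP s)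
      _ = (1 + ρ) / 2 * y + (C + 1) + ∑ s, P s * W s := by
          simp only [mul_add, Finset.sum_add_distrib, ← Finset.sum_mul, hP1, one_mul]
      _ ≤ _ := by rw [hC₂]; linarith
  have hΨ : escapePotential h b η x y = 1 + b * y := by
    rw [escapePotential, if_neg (not_le.2 hz)]
  rw [hΨ]
  by_cases hyY : Y ≤ y
  · calc ∑ s, P s * escapePotential h b η (x' s) (y' s)
        ≤ ∑ s, P s * (1 + b * y' s) := Finset.sum_le_sum fun s _ =>
          mul_le_mul_of_nonneg_left (escapePotential_le (by linarith) hb.le (hy' s)) (hP s)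
      _ = 1 + b * ∑ s, P s * y' s := by
          simp only [mul_add, Finset.sum_add_distrib, mul_one, hP1, Finset.mul_sum]
          congr 1
          exact Finset.sum_congr rfl fun s _ => by ring
      _ ≤ 1 + b * ((1 + ρ) / 2 * y + C₂) := by gcongr
      _ ≤ _ := by
          -- Of the gain `(1 - ρ)/2 · b y`, half pays for `ε b y`. The other half is at least `2 b
          -- C₂`, by the factor 8 in the choice of `Y`, and covers `b C₂` and `ε`.
          have e1 : (1 - ρ) * Y ≤ (1 - ρ) * y := mul_le_mul_of_nonneg_left hyY (by linarith)
          have e2 : ε * (b * y) ≤ (1 - ρ) / 4 * (b * y) :=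
            mul_le_mul_of_nonneg_right hερ (by positivity)
          have e3 : b * ((1 - ρ) * Y) ≤ b * ((1 - ρ) * y) := mul_le_mul_of_nonneg_left e1 hb.le
          rw [hY] at e3
          nlinarith
  · push Not at hyY
    have hpt : ∀ s, P s * escapePotential h b η (x' s) (y' s)
        ≤ P s * (1 + b * y' s) - (1 / 2) * (if 2 * h + 1 ≤ x' s ∧ W s ≤ M then P s else 0) := by
      intro s
      split_ifs with hj
      · have hy1 : y' s ≤ Y + C + 1 + M := by
          have := hdy1 s
          have : (1 + ρ) / 2 * y ≤ 1 * y := mul_le_mul_of_nonneg_right (by linarith) hy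
          linarith [hj.2]
        have hz' : 2 * h ≤ x' s - η * y' s := by
          have := mul_le_mul_of_nonneg_left hy1 hη.le
          linarith [hj.1]
        have h1 := mul_le_mul_of_nonneg_left
          (escapePotential_le_half (b := b) (by linarith : 0 < h) hz') (hP s)
        have h2 : 0 ≤ P s * (b * y' s) := by have := hP s; have := hy' s; positivity
        linarith
      · have := mul_le_mul_of_nonneg_left
          (escapePotential_le (x := x' s) (η := η) (by linarith : 0 < h) hb.le (hy' s)) (hP s)
        linarith
    calc ∑ s, P s * escapePotential h b η (x' s) (y' s)
        ≤ ∑ s, (P s * (1 + b * y' s)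
            - (1 / 2) * (if 2 * h + 1 ≤ x' s ∧ W s ≤ M then P s else 0)) :=
          Finset.sum_le_sum fun s _ => hpt s
      _ = 1 + b * ∑ s, P s * y' s
            - (1 / 2) * ∑ s, (if 2 * h + 1 ≤ x' s ∧ W s ≤ M then P s else 0) := by
          rw [Finset.sum_sub_distrib, ← Finset.mul_sum]
          congr 1
          simp only [mul_add, Finset.sum_add_distrib, mul_one, hP1, Finset.mul_sum]
          congr 1
          exact Finset.sum_congr rfl fun s _ => by ring
      _ ≤ 1 + b * ((1 + ρ) / 2 * y + C₂) - (1 / 2) * c := by gcongr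
      _ ≤ 1 + b * (Y + C₂) - (1 / 2) * c := by
          have : (1 + ρ) / 2 * y ≤ 1 * y := mul_le_mul_of_nonneg_right (by linarith) hy
          have : b * ((1 + ρ) / 2 * y + C₂) ≤ b * (Y + C₂) :=
            mul_le_mul_of_nonneg_left (by linarith) hb.le
          linarith
      _ ≤ 1 - ε := by linarith
      _ ≤ (1 - ε) * (1 + b * y) := by
          have : 0 ≤ (1 - ε) * (b * y) := mul_nonneg (by linarith) (by positivity)
          linarith

open Classical in
/-- The potential decreases in mean by a constant factor at every step of a process with an
expanding coordinate `x`, a contracting coordinate `y`, fluctuations `W` of bounded second moment,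
and a bounded chance of making `x` as large as a given constant. -/
theorem exists_escapePotential_contraction {l ρ C Q : ℝ} (hl : 1 < l) (hl2 : l ≤ 2)
    (hρ1 : ρ < 1) (hC : 0 ≤ C) (hQ : 0 ≤ Q) (c M : ℝ → ℝ) (hc : ∀ H, 0 < c H) (hM : ∀ H, 0 ≤ M H) :
    ∃ δ h b η θ H : ℝ, 0 < δ ∧ 0 < h ∧ 0 ≤ b ∧ 0 ≤ η ∧ 0 < θ ∧ θ < 1 ∧ 0 ≤ H ∧
      ∀ {S : Type} [Fintype S] (P x' y' W : S → ℝ) (x y : ℝ),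
        (∀ s, 0 ≤ P s) → ∑ s, P s = 1 → 0 ≤ x → 0 ≤ y → (∀ s, 0 ≤ y' s) → (∀ s, 0 ≤ W s) →
        (∀ s, l * x - δ * y - C - W s ≤ x' s) → (∀ s, y' s ≤ ρ * y + δ * x + C + W s) →
        ∑ s, P s * W s ^ 2 ≤ Q →
        (c H ≤ ∑ s, if H ≤ x' s ∧ W s ≤ M H then P s else 0) →
        ∑ s, P s * escapePotential h b η (x' s) (y' s) ≤ θ * escapePotential h b η x y := by
  -- The order of choice avoids circularity: `h` and the jump height `H` depend only on `l`, `C`,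
  -- `Q`; then `c H` and `M H` are available, and `η`, `δ`, `b`, `ε` are taken small in terms of
  -- them.
  set κ : ℝ := (l - 1) / 8 with hκ
  have hκ0 : 0 < κ := by rw [hκ]; linarith
  have hκ1 : κ ≤ 1 / 8 := by rw [hκ]; linarith
  set h : ℝ := 1 + C + 2 * C / κ + 5 * Q / κ ^ 3 with hh
  have q1 : 0 ≤ 2 * C / κ := by positivity
  have q2 : 0 ≤ 5 * Q / κ ^ 3 := by positivity
  have hh1 : 1 ≤ h := by linarith
  have hh0 : 0 < h := by linarith
  -- After a jump with `η y' ≤ 1` this height leaves `z ≥ 2h`, where the potential is at most 1/2.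
  set H : ℝ := 2 * h + 1 with hH
  set C₂ : ℝ := C + 2 + Q with hC₂
  have hC₂0 : 0 < C₂ := by positivity
  have hρ' : 0 < 1 - ρ := by linarith
  set Y : ℝ := 8 * C₂ / (1 - ρ) with hY
  have hY0 : 0 < Y := by positivity
  have hcH := hc H
  have hMH := hM H
  set η : ℝ := 1 / (1 + (Y + C + 1 + M H)) with hη
  have hη0 : 0 < η := by positivity
  have hη1 : η ≤ 1 := by
    rw [hη, div_le_one (by positivity)]
    linarith
  have hηY : η * (Y + C + 1 + M H) ≤ 1 := by
    rw [hη, div_mul_eq_mul_div, div_le_one (by positivity)]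
    linarith
  set δ : ℝ := min (η * (1 - ρ) / 2) (κ / h) with hδ
  have hδ0 : 0 < δ := lt_min (by positivity) (by positivity)
  have hδ1 : δ ≤ η * (1 - ρ) / 2 := min_le_left _ _
  have hδ2 : δ * h ≤ κ := (le_div_iff₀ hh0).1 (min_le_right _ _)
  set b : ℝ := min η (c H / 4 / (Y + C₂)) with hb
  have hb0 : 0 < b := lt_min hη0 (by positivity)
  have hbY : b * (Y + C₂) ≤ c H / 4 := (le_div_iff₀ (by positivity)).1 (min_le_right _ _)
  set ε : ℝ := min (min κ (b * C₂)) (min ((1 - ρ) / 4) (c H / 4)) with hε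
  have hε0 : 0 < ε := by
    refine lt_min (lt_min hκ0 (by positivity)) (lt_min (by positivity) (by positivity))
  have hε1 : ε ≤ κ := (min_le_left _ _).trans (min_le_left _ _)
  have hε2 : ε ≤ b * C₂ := (min_le_left _ _).trans (min_le_right _ _)
  have hε3 : ε ≤ (1 - ρ) / 4 := (min_le_right _ _).trans (min_le_left _ _)
  have hε4 : ε ≤ c H / 4 := (min_le_right _ _).trans (min_le_right _ _)
  refine ⟨δ, h, b, η, 1 - ε, H, hδ0, hh0, hb0.le, hη0.le, by linarith, by linarith, by linarith,
    ?_⟩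
  intro S _ P x' y' W x y hP hP1 hx hy hy' hW hdx hdy hWV hjump
  by_cases hz : h ≤ x - η * y
  · refine (sum_mul_escapePotential_le_of_expanding hP hP1 hx hy hy' hW hρ1 hκ0 hκ1
      (l := l) (by rw [hκ]; ring) hC hh1 (by linarith) ?_ ?_ hη0 hη1 hδ0 ?_ ?_ hb0.le
      (min_le_left _ _) hdx hdy hWV hz).trans ?_
    · have : κ * (2 * C / κ) = 2 * C := by field_simp
      have : κ * (2 * C / κ) ≤ κ * h := mul_le_mul_of_nonneg_left (by linarith) hκ0.le
      linarith
    · have : κ ^ 3 * (5 * Q / κ ^ 3) = 5 * Q := by field_simp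
      have : κ ^ 3 * (5 * Q / κ ^ 3) ≤ κ ^ 3 * h :=
        mul_le_mul_of_nonneg_left (by linarith) (by positivity)
      linarith
    · nlinarith
    · nlinarith
    · exact mul_le_mul_of_nonneg_right (by linarith) (escapePotential_nonneg hh0 hb0.le hy)
  · push Not at hz
    refine sum_mul_escapePotential_le_of_contracting hP hP1 hy hy' hh1 hη0 hη1
      hδ0 (by linarith) ?_ hb0 hC₂ ?_ hηY hbY hε0 hε2 hε3 hε4 (by linarith) hdy hWV hjump hz
    · nlinarith
    · rw [hY]; field_simp

end Potential

/-! ### Exit times of finite Markov chains given by their finite-dimensional distributions. -/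

section Chain

open MeasureTheory

variable {S : Type*} {Ω : Type*} [MeasurableSpace Ω]

/-- The probability that the process `X` starts with the path `b`. -/
noncomputable def pathLaw (μ : Measure Ω) (X : ℕ → Ω → S) (t : ℕ) (b : Fin (t + 1) → S) : ℝ :=
  μ.real {ω | ∀ s : Fin (t + 1), X s ω = b s}

/-- The finite-dimensional distributions of `X` are those of the Markov chain with transition
matrix `p` started from `s₀`. -/
def HasChainLaw [DecidableEq S] (p : S → S → ℝ) (s₀ : S) (μ : Measure Ω) (X : ℕ → Ω → S) : Prop :=
  ∀ (t : ℕ) (B : ℕ → S), μ.real {ω | ∀ s ≤ t, X s ω = B s}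
    = (if B 0 = s₀ then 1 else 0) * ∏ s ∈ Finset.range t, p (B s) (B (s + 1))

variable {μ : Measure Ω} {X : ℕ → Ω → S}

theorem pathLaw_nonneg (t : ℕ) (b : Fin (t + 1) → S) : 0 ≤ pathLaw μ X t b :=
  measureReal_nonneg

theorem pathLaw_eq (t : ℕ) (b : Fin (t + 1) → S) (B : ℕ → S) (hB : ∀ s : Fin (t + 1), B s = b s) :
    pathLaw μ X t b = μ.real {ω | ∀ s ≤ t, X s ω = B s} := by
  rw [pathLaw]
  congr 1
  ext ω
  simp only [Set.mem_ofPred_eq]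
  constructor
  · intro h s hs
    have := h ⟨s, Nat.lt_succ_of_le hs⟩
    rw [← hB] at this
    exact this
  · intro h s
    rw [← hB]
    exact h s (Nat.le_of_lt_succ s.2)

section Law

variable [DecidableEq S] {p : S → S → ℝ} {s₀ : S}

theorem pathLaw_zero (h : HasChainLaw p s₀ μ X) (b : Fin 1 → S) :
    pathLaw μ X 0 b = if b 0 = s₀ then 1 else 0 := by
  rw [pathLaw_eq 0 b (fun _ => b 0) (fun s => by rw [Fin.fin_one_eq_zero s]), h 0]
  simp

theorem pathLaw_snoc (h : HasChainLaw p s₀ μ X) (t : ℕ) (b : Fin (t + 1) → S) (s : S) :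
    pathLaw μ X (t + 1) (Fin.snoc b s : Fin (t + 2) → S)
      = pathLaw μ X t b * p (b (Fin.last t)) s := by
  -- One infinite sequence extends both the path and its prolongation by `s`; the values after time
  -- `t + 1` play no role.
  set B : ℕ → S := fun n => if hn : n < t + 1 then b ⟨n, hn⟩ else s with hB
  have h1 : ∀ k : Fin (t + 1), B k = b k := fun k => by
    simp only [hB]
    rw [dif_pos k.2]
  have h2 : ∀ k : Fin (t + 2), B k = (Fin.snoc b s : Fin (t + 2) → S) k := by
    intro k
    refine Fin.lastCases ?_ (fun k => ?_) k
    · simp [hB]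
    · rw [Fin.val_castSucc, h1, Fin.snoc_castSucc]
  rw [pathLaw_eq _ _ B h2, pathLaw_eq _ _ B h1, h, h, Finset.prod_range_succ, mul_assoc]
  have e1 : B t = b (Fin.last t) := h1 (Fin.last t)
  have e2 : B (t + 1) = s := by simp [hB]
  rw [e1, e2]

end Law

variable [Fintype S]

open Classical in
theorem measureReal_eq_sum_pathLaw [IsProbabilityMeasure μ]
    (hX : ∀ (t : ℕ) (B : S), MeasurableSet {ω | X t ω = B}) (t : ℕ) (Q : (Fin (t + 1) → S) → Prop)
    {E : Set Ω} (hE : ∀ ω, ω ∈ E ↔ Q fun s => X s ω) :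
    μ.real E = ∑ b, if Q b then pathLaw μ X t b else 0 := by
  have hm : ∀ b ∈ Finset.univ.filter Q,
      MeasurableSet ((fun ω (s : Fin (t + 1)) => X s ω) ⁻¹' {b}) := by
    intro b _
    have : (fun ω (s : Fin (t + 1)) => X s ω) ⁻¹' {b} = ⋂ s : Fin (t + 1), {ω | X s ω = b s} := by
      ext ω; simp [funext_iff]
    rw [this]
    exact MeasurableSet.iInter fun s => hX s (b s)
  have := sum_measureReal_preimage_singleton (μ := μ) (Finset.univ.filter Q) hm
  rw [Finset.sum_filter] at this
  have e : E = (fun ω (s : Fin (t + 1)) => X s ω) ⁻¹' ↑(Finset.univ.filter Q) := by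
    ext ω; simp [hE]
  rw [e, ← this]
  refine Finset.sum_congr rfl fun b _ => ?_
  congr 2
  ext ω
  simp [funext_iff]

theorem sum_pathLaw [IsProbabilityMeasure μ]
    (hX : ∀ (t : ℕ) (B : S), MeasurableSet {ω | X t ω = B}) (t : ℕ) :
    ∑ b, pathLaw μ X t b = 1 := by
  have := measureReal_eq_sum_pathLaw (μ := μ) hX t (fun _ => True) (E := Set.univ) (by simp)
  simpa using this.symm

theorem sum_eq_sum_snoc (t : ℕ) (F : (Fin (t + 2) → S) → ℝ) :
    ∑ b, F b = ∑ b : Fin (t + 1) → S, ∑ s, F (Fin.snoc b s : Fin (t + 2) → S) := by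
  rw [← (Fin.snocEquiv fun _ : Fin (t + 2) => S).sum_comp, Fintype.sum_prod_type, Finset.sum_comm]
  rfl

variable [DecidableEq S] {p : S → S → ℝ} {s₀ : S}

-- The supermartingale estimate for the chain killed on leaving `R`: the restricted mean of `Ψ` is
-- multiplied by at most `θ` at each step. Terms that leave `R` are dropped, as `Ψ ≥ 0`.
open Classical in
theorem sum_pathLaw_mul_le (h : HasChainLaw p s₀ μ X) (hp : ∀ A B, 0 ≤ p A B) {R : S → Prop}
    {Ψ : S → ℝ} {θ : ℝ} (hθ : 0 ≤ θ) (hΨ : ∀ A, 0 ≤ Ψ A)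
    (hd : ∀ A, R A → ∑ B, p A B * Ψ B ≤ θ * Ψ A) (t : ℕ) :
    (∑ b : Fin (t + 1) → S, if ∀ s, R (b s) then pathLaw μ X t b * Ψ (b (Fin.last t)) else 0)
      ≤ θ ^ t * Ψ s₀ := by
  induction t with
  | zero =>
    rw [pow_zero, one_mul]
    refine (Finset.sum_le_sum (g := fun b : Fin 1 → S =>
      if b = (fun _ => s₀) then Ψ s₀ else 0) fun b _ => ?_).trans (by simp)
    rw [pathLaw_zero h]
    have hb : b = (fun _ => s₀) ↔ b 0 = s₀ := by
      constructor
      · rintro rfl; rfl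
      · intro h0; funext i; rw [Subsingleton.elim i 0, h0]
    simp only [hb]
    have : b (Fin.last 0) = b 0 := rfl
    rw [this]
    split_ifs with h1 h2 h2
    · rw [h2, one_mul]
    · simp
    · exact hΨ _
    · exact le_rfl
  | succ t ih =>
    rw [sum_eq_sum_snoc]
    calc _ ≤ ∑ b : Fin (t + 1) → S, θ *
            (if ∀ s, R (b s) then pathLaw μ X t b * Ψ (b (Fin.last t)) else 0) := by
          refine Finset.sum_le_sum fun b _ => ?_
          by_cases hb : ∀ s, R (b s)
          · rw [if_pos hb]
            calc _ ≤ ∑ s, pathLaw μ X t b * (p (b (Fin.last t)) s * Ψ s) := by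
                  refine Finset.sum_le_sum fun s _ => ?_
                  rw [pathLaw_snoc h, Fin.snoc_last]
                  have := mul_nonneg (pathLaw_nonneg (μ := μ) (X := X) t b)
                    (mul_nonneg (hp (b (Fin.last t)) s) (hΨ s))
                  split_ifs
                  · rw [mul_assoc]
                  · exact this
              _ = pathLaw μ X t b * ∑ s, p (b (Fin.last t)) s * Ψ s := by rw [Finset.mul_sum]
              _ ≤ pathLaw μ X t b * (θ * Ψ (b (Fin.last t))) :=
                  mul_le_mul_of_nonneg_left (hd _ (hb _)) (pathLaw_nonneg t b)
              _ = _ := by ring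
          · rw [if_neg hb, mul_zero]
            refine (Finset.sum_eq_zero fun s _ => if_neg fun hs => hb fun k => ?_).le
            have := hs k.castSucc
            rwa [Fin.snoc_castSucc] at this
      _ = θ * _ := by rw [Finset.mul_sum]
      _ ≤ θ * (θ ^ t * Ψ s₀) := mul_le_mul_of_nonneg_left ih hθ
      _ = _ := by ring

theorem measureReal_forall_le [IsProbabilityMeasure μ]
    (hX : ∀ (t : ℕ) (B : S), MeasurableSet {ω | X t ω = B})
    (h : HasChainLaw p s₀ μ X) (hp : ∀ A B, 0 ≤ p A B) {R : S → Prop}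
    {Ψ : S → ℝ} {θ m : ℝ} (hθ : 0 ≤ θ) (hm : 0 < m) (hΨ : ∀ A, 0 ≤ Ψ A)
    (hΨm : ∀ A, R A → m ≤ Ψ A)
    (hd : ∀ A, R A → ∑ B, p A B * Ψ B ≤ θ * Ψ A) (t : ℕ) :
    μ.real {ω | ∀ s ≤ t, R (X s ω)} ≤ θ ^ t * Ψ s₀ / m := by
  classical
  have e : ∀ ω, ω ∈ {ω | ∀ s ≤ t, R (X s ω)}
      ↔ (fun b : Fin (t + 1) → S => ∀ s, R (b s)) fun s => X s ω := fun ω =>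
    ⟨fun H s => H s (Nat.le_of_lt_succ s.2), fun H s hs => H ⟨s, Nat.lt_succ_of_le hs⟩⟩
  rw [measureReal_eq_sum_pathLaw hX t (fun b => ∀ s, R (b s)) e, le_div_iff₀ hm, Finset.sum_mul]
  refine le_trans (Finset.sum_le_sum fun b _ => ?_) (sum_pathLaw_mul_le h hp hθ hΨ hd t)
  split_ifs with hb
  · exact mul_le_mul_of_nonneg_left (hΨm _ (hb _)) (pathLaw_nonneg t b)
  · simp

open Classical in
theorem measureReal_step_le [IsProbabilityMeasure μ]
    (hX : ∀ (t : ℕ) (B : S), MeasurableSet {ω | X t ω = B})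
    (h : HasChainLaw p s₀ μ X) {R D : S → Prop} {ε : ℝ} (hε : 0 ≤ ε)
    (hd : ∀ A, R A → ∑ B, (if D B then p A B else 0) ≤ ε) (t : ℕ) :
    μ.real {ω | R (X t ω) ∧ D (X (t + 1) ω)} ≤ ε := by
  rw [measureReal_eq_sum_pathLaw hX (t + 1)
    (fun b => R (b (Fin.last t).castSucc) ∧ D (b (Fin.last (t + 1)))) (by simp), sum_eq_sum_snoc]
  calc _ ≤ ∑ b, pathLaw μ X t b * ε := by
        refine Finset.sum_le_sum fun b _ => ?_
        simp only [Fin.snoc_castSucc, Fin.snoc_last, pathLaw_snoc h]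
        by_cases hb : R (b (Fin.last t))
        · refine le_trans (le_of_eq ?_)
            (mul_le_mul_of_nonneg_left (hd _ hb) (pathLaw_nonneg t b))
          rw [Finset.mul_sum]
          exact Finset.sum_congr rfl fun s _ => by simp [hb]
        · simp only [hb, false_and, if_false, Finset.sum_const_zero]
          exact mul_nonneg (pathLaw_nonneg t b) hε
    _ = ε := by rw [← Finset.sum_mul, sum_pathLaw hX, one_mul]

open Classical in
/-- A chain started in `R` leaves `R` before time `T`, and does so into `D`, except on an event
whose probability is controlled by a potential decreasing on `R` and by the one-step
probabilities of jumping from `R` to the complement of `D`. -/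
theorem one_sub_le_measureReal_exit [IsProbabilityMeasure μ]
    (hX : ∀ (t : ℕ) (B : S), MeasurableSet {ω | X t ω = B})
    (h : HasChainLaw p s₀ μ X) (hp : ∀ A B, 0 ≤ p A B) {R D : S → Prop}
    {Ψ : S → ℝ} {θ m ε : ℝ} (hθ : 0 ≤ θ) (hm : 0 < m) (hε : 0 ≤ ε) (hΨ : ∀ A, 0 ≤ Ψ A)
    (hΨm : ∀ A, R A → m ≤ Ψ A)
    (hd : ∀ A, R A → ∑ B, p A B * Ψ B ≤ θ * Ψ A)
    (hD : ∀ A, R A → ∑ B, (if ¬ D B then p A B else 0) ≤ ε) (hs₀ : R s₀) (T : ℕ) :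
    1 - (θ ^ T * Ψ s₀ / m + T * ε) ≤ μ.real {ω | ∃ τ ≤ T, ¬ R (X τ ω) ∧ D (X τ ω)} := by
  have h0 : μ.real {ω | X 0 ω ≠ s₀} = 0 := by
    rw [measureReal_eq_sum_pathLaw hX 0 (fun b => b 0 ≠ s₀) (by simp)]
    refine Finset.sum_eq_zero fun b _ => ?_
    rw [pathLaw_zero h]
    split_ifs <;> simp_all
  have hcov : (Set.univ : Set Ω) ⊆ {ω | ∃ τ ≤ T, ¬ R (X τ ω) ∧ D (X τ ω)} ∪
      ({ω | ∀ s ≤ T, R (X s ω)} ∪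
        ((⋃ t ∈ Finset.range T, {ω | R (X t ω) ∧ ¬ D (X (t + 1) ω)}) ∪ {ω | X 0 ω ≠ s₀})) := by
    intro ω _
    by_cases hω0 : X 0 ω = s₀
    · by_cases hst : ∀ s ≤ T, R (X s ω)
      · exact Or.inr (Or.inl hst)
      · push Not at hst
        -- At the first exit time either the chain is in `D`, or the preceding step jumped from `R`
        -- to the complement of `D`. Time 0 is excluded because the start lies in `R`, outside a
        -- null event.
        have hτ := Nat.find_spec hst
        have hmin := fun k => Nat.find_min hst (m := k)
        generalize Nat.find hst = τ at hτ hmin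
        by_cases hDτ : D (X τ ω)
        · exact Or.inl ⟨τ, hτ.1, hτ.2, hDτ⟩
        · rcases τ with _ | t
          · exact absurd (hω0 ▸ hs₀) hτ.2
          · refine Or.inr (Or.inr (Or.inl ?_))
            simp only [Set.mem_iUnion, Finset.mem_range]
            refine ⟨t, by omega, ?_, hDτ⟩
            by_contra hR
            exact hmin t (by omega) ⟨by omega, hR⟩
    · exact Or.inr (Or.inr (Or.inr hω0))
  have h1 : μ.real (Set.univ : Set Ω) = 1 := probReal_univ
  have h2 := measureReal_mono (μ := μ) hcov
  have h3 := measureReal_forall_le hX h hp hθ hm hΨ hΨm hd T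
  have h4 : μ.real (⋃ t ∈ Finset.range T, {ω | R (X t ω) ∧ ¬ D (X (t + 1) ω)}) ≤ T * ε := by
    refine (measureReal_biUnion_finset_le _ _).trans ?_
    refine (Finset.sum_le_sum fun t _ => measureReal_step_le hX h
      (D := fun B => ¬ D B) hε (fun A hA => by convert hD A hA) t).trans ?_
    simp
  have h5 := measureReal_union_le (μ := μ) {ω | ∃ τ ≤ T, ¬ R (X τ ω) ∧ D (X τ ω)}
    ({ω | ∀ s ≤ T, R (X s ω)} ∪
        ((⋃ t ∈ Finset.range T, {ω | R (X t ω) ∧ ¬ D (X (t + 1) ω)}) ∪ {ω | X 0 ω ≠ s₀}))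
  have h6 := measureReal_union_le (μ := μ) {ω | ∀ s ≤ T, R (X s ω)}
    ((⋃ t ∈ Finset.range T, {ω | R (X t ω) ∧ ¬ D (X (t + 1) ω)}) ∪ {ω | X 0 ω ≠ s₀})
  have h7 := measureReal_union_le (μ := μ)
    (⋃ t ∈ Finset.range T, {ω | R (X t ω) ∧ ¬ D (X (t + 1) ω)}) {ω | X 0 ω ≠ s₀}
  linarith

end Chain

/-! ### Mean and variance of the densities after one step. -/

section Step

variable {n : ℕ} {f₁ f₂ : ℝ[X]} {G : SimpleGraph (Vertex n)}

theorem ratio_mem_Icc (G : SimpleGraph (Vertex n)) (A : Finset (Vertex n)) (v : Vertex n) :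
    ratio G A v ∈ Set.Icc (0 : ℝ) 1 := by
  have h : degIn G A v ≤ degIn G Finset.univ v :=
    Set.ncard_le_ncard (fun w hw => ⟨hw.1, Finset.mem_univ w⟩) (Set.toFinite _)
  refine ⟨by unfold ratio; positivity, ?_⟩
  exact div_le_one_of_le₀ (by exact_mod_cast h) (by positivity)

theorem vertexProb_mem_Icc (hf₁ : ∀ x ∈ Set.Icc (0 : ℝ) 1, f₁.eval x ∈ Set.Icc (0 : ℝ) 1)
    (hf₂ : ∀ x ∈ Set.Icc (0 : ℝ) 1, f₂.eval x ∈ Set.Icc (0 : ℝ) 1) (A : Finset (Vertex n))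
    (v : Vertex n) : vertexProb f₁ f₂ G A v ∈ Set.Icc (0 : ℝ) 1 := by
  unfold vertexProb
  split_ifs
  exacts [hf₁ _ (ratio_mem_Icc G A v), hf₂ _ (ratio_mem_Icc G A v)]

theorem stepProb_eq_bernoulliWeight (A B : Finset (Vertex n)) :
    stepProb f₁ f₂ G A B = bernoulliWeight (vertexProb f₁ f₂ G A) B := rfl

theorem sum_stepProb (A : Finset (Vertex n)) : ∑ B, stepProb f₁ f₂ G A B = 1 :=
  sum_bernoulliWeight _

theorem density_eq_sum (B : Finset (Vertex n)) (k : Fin 2) :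
    density B k = ∑ v : Vertex n, (if v.1 = k then 1 / (n : ℝ) else 0) * (if v ∈ B then 1 else 0) := by
  rw [density, part, Finset.card_filter, Nat.cast_sum, Finset.sum_div,
    ← Finset.sum_filter_add_sum_filter_not Finset.univ (fun v => v ∈ B)]
  rw [Finset.sum_eq_zero (s := Finset.univ.filter fun v => v ∉ B)
    (fun v hv => by simp [(Finset.mem_filter.1 hv).2]), add_zero]
  rw [Finset.filter_univ_mem]
  refine Finset.sum_congr rfl fun v hv => ?_
  by_cases h : v.1 = k <;> simp [hv, h]

theorem density_mem_Icc (B : Finset (Vertex n)) : density B ∈ Set.Icc (0 : Fin 2 → ℝ) 1 := by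
  refine ⟨fun k => by simp only [density, Pi.zero_apply]; positivity, fun k => ?_⟩
  refine div_le_one_of_le₀ ?_ (by positivity)
  have : (part B k).card ≤ (Finset.univ.image fun j : Fin n => (k, j)).card := by
    refine Finset.card_le_card fun v hv => ?_
    have hk := (Finset.mem_filter.1 hv).2
    exact Finset.mem_image.2 ⟨v.2, Finset.mem_univ _, by rw [← hk]⟩
  have h2 : (Finset.univ.image fun j : Fin n => (k, j)).card ≤ n :=
    Finset.card_image_le.trans (by simp)
  exact Nat.cast_le.2 (this.trans h2)

theorem stepExp_density (A : Finset (Vertex n)) (k : Fin 2) :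
    stepExp f₁ f₂ G A (fun B => density B k)
      = ∑ v : Vertex n, (if v.1 = k then 1 / (n : ℝ) else 0) * vertexProb f₁ f₂ G A v := by
  simp only [stepExp, density_eq_sum, smul_eq_mul, Finset.mul_sum]
  rw [Finset.sum_comm]
  refine Finset.sum_congr rfl fun v _ => ?_
  rw [← sum_bernoulliWeight_mul_indicator (vertexProb f₁ f₂ G A) v, Finset.mul_sum]
  exact Finset.sum_congr rfl fun B _ => by rw [stepProb_eq_bernoulliWeight]; ring

/-- The link to the Bernoulli estimates: every real linear functional of the density fluctuation is
a centred sum with weights of size O(1/n). -/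
theorem sum_mul_density_sub_stepExp (A B : Finset (Vertex n)) (c : Fin 2 → ℝ) :
    ∑ k, c k * (density B k - stepExp f₁ f₂ G A fun B => density B k)
      = centredSum (vertexProb f₁ f₂ G A) (fun v => c v.1 / n) B := by
  simp only [stepExp_density]
  simp only [density_eq_sum, ← Finset.sum_sub_distrib, Finset.mul_sum, centredSum]
  rw [Finset.sum_comm]
  refine Finset.sum_congr rfl fun v _ => ?_
  rw [Finset.sum_eq_single v.1 (fun k _ hk => by simp [Ne.symm hk]) (by simp)]
  simp only [if_true]
  ring

theorem stepVar_density (A : Finset (Vertex n)) (k : Fin 2) :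
    stepVar f₁ f₂ G A (fun B => density B k)
      = ∑ v : Vertex n, if v.1 = k then
          1 / (n : ℝ) ^ 2 * (vertexProb f₁ f₂ G A v * (1 - vertexProb f₁ f₂ G A v)) else 0 := by
  have h : ∀ B : Finset (Vertex n), density B k - stepExp f₁ f₂ G A (fun B => density B k)
      = centredSum (vertexProb f₁ f₂ G A) (fun v => (if v.1 = k then 1 else 0) / n) B := by
    intro B
    rw [← sum_mul_density_sub_stepExp A B (fun j => if j = k then 1 else 0)]
    simp
  simp only [stepVar, h]
  rw [stepExp]
  simp only [smul_eq_mul, stepProb_eq_bernoulliWeight]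
  rw [sum_bernoulliWeight_mul_centredSum_sq, bernoulliVar]
  refine Finset.sum_congr rfl fun v _ => ?_
  split_ifs <;> simp

theorem bernoulliVar_eq_sum_stepVar (A : Finset (Vertex n)) (c : Fin 2 → ℝ) :
    bernoulliVar (vertexProb f₁ f₂ G A) (fun v => c v.1 / n)
      = ∑ k, c k ^ 2 * stepVar f₁ f₂ G A (fun B => density B k) := by
  simp only [stepVar_density, Finset.mul_sum, bernoulliVar]
  rw [Finset.sum_comm]
  refine Finset.sum_congr rfl fun v _ => ?_
  rw [Finset.sum_eq_single v.1 (fun k _ hk => by simp [Ne.symm hk]) (by simp)]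
  simp only [if_true]
  ring

theorem stepVar_density_le (hf₁ : ∀ x ∈ Set.Icc (0 : ℝ) 1, f₁.eval x ∈ Set.Icc (0 : ℝ) 1)
    (hf₂ : ∀ x ∈ Set.Icc (0 : ℝ) 1, f₂.eval x ∈ Set.Icc (0 : ℝ) 1) (hn : 0 < n)
    (A : Finset (Vertex n)) (k : Fin 2) :
    stepVar f₁ f₂ G A (fun B => density B k) ≤ 1 / n := by
  have hn' : (0 : ℝ) < n := by exact_mod_cast hn
  rw [stepVar_density]
  calc _ ≤ ∑ v : Vertex n, if v.1 = k then 1 / (n : ℝ) ^ 2 else 0 := by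
        refine Finset.sum_le_sum fun v _ => ?_
        split_ifs
        · obtain ⟨h0, h1⟩ := vertexProb_mem_Icc (G := G) hf₁ hf₂ A v
          refine mul_le_of_le_one_right (by positivity) ?_
          nlinarith
        · exact le_rfl
    _ = 1 / (n : ℝ) := by
        rw [Fintype.sum_prod_type, Finset.sum_eq_single k (fun j _ hj => by simp [hj]) (by simp)]
        simp
        field_simp

theorem sum_stepProb_mul_density_sub_sq (A : Finset (Vertex n)) (k : Fin 2) :
    ∑ B, stepProb f₁ f₂ G A B * (density B k - stepExp f₁ f₂ G A fun B => density B k) ^ 2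
      = stepVar f₁ f₂ G A (fun B => density B k) := by
  simp only [stepVar, stepExp, smul_eq_mul]

end Step

/-! ### Fluctuations of the eigencoordinates and the probability of a jump. -/

section Beta

variable {n : ℕ} {f₁ f₂ : ℝ[X]} {G : SimpleGraph (Vertex n)} {u : Fin 2 → Fin 2 → ℂ}
  {a : Fin 2 → ℝ}

/-- The inverse of the matrix whose columns are the given vectors. -/
noncomputable def coordMatrix (u : Fin 2 → Fin 2 → ℂ) : Matrix (Fin 2) (Fin 2) ℂ :=
  (Matrix.of fun k i => u i k)⁻¹

/-- The sum of the moduli of the entries of the coordinate matrix. -/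
noncomputable def coordBound (u : Fin 2 → Fin 2 → ℂ) : ℝ := ∑ i, ∑ k, ‖coordMatrix u i k‖

theorem coordBound_nonneg (u : Fin 2 → Fin 2 → ℂ) : 0 ≤ coordBound u := by
  unfold coordBound; positivity

theorem norm_coordMatrix_le (u : Fin 2 → Fin 2 → ℂ) (i k : Fin 2) :
    ‖coordMatrix u i k‖ ≤ coordBound u := by
  refine le_trans ?_ (Finset.single_le_sum (f := fun i => ∑ k, ‖coordMatrix u i k‖)
    (fun i _ => by positivity) (Finset.mem_univ i))
  exact Finset.single_le_sum (f := fun k => ‖coordMatrix u i k‖) (fun k _ => norm_nonneg _)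
    (Finset.mem_univ k)

theorem eigenCoord_apply (x : Fin 2 → ℝ) (i : Fin 2) :
    eigenCoord u a x i = ∑ k, coordMatrix u i k * ((x k - a k : ℝ) : ℂ) := rfl

theorem stepExp_beta (A : Finset (Vertex n)) (i : Fin 2) :
    stepExp f₁ f₂ G A (fun B => beta u a B i)
      = eigenCoord u a (fun k => stepExp f₁ f₂ G A fun B => density B k) i := by
  rw [eigenCoord_apply]
  simp only [stepExp, beta, eigenCoord_apply, Finset.smul_sum]
  rw [Finset.sum_comm]
  refine Finset.sum_congr rfl fun k _ => ?_
  have h1 : (((∑ B, stepProb f₁ f₂ G A B • density B k) - a k : ℝ) : ℂ)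
      = ∑ B, (stepProb f₁ f₂ G A B : ℂ) * ((density B k - a k : ℝ) : ℂ) := by
    have : (∑ B, stepProb f₁ f₂ G A B • density B k) - a k
        = ∑ B, stepProb f₁ f₂ G A B * (density B k - a k) := by
      simp only [mul_sub, Finset.sum_sub_distrib, ← Finset.sum_mul, sum_stepProb, one_mul,
        smul_eq_mul]
    rw [this]
    push_cast
    rfl
  rw [h1, Finset.mul_sum]
  refine Finset.sum_congr rfl fun B _ => ?_
  rw [Complex.real_smul]
  ring

theorem beta_sub_stepExp (A B : Finset (Vertex n)) (i : Fin 2) :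
    beta u a B i - stepExp f₁ f₂ G A (fun B => beta u a B i)
      = ∑ k, coordMatrix u i k *
        ((density B k - stepExp f₁ f₂ G A (fun B => density B k) : ℝ) : ℂ) := by
  rw [stepExp_beta, beta, eigenCoord_apply, eigenCoord_apply, ← Finset.sum_sub_distrib]
  refine Finset.sum_congr rfl fun k _ => ?_
  push_cast
  ring

/-- The fluctuation of `β'` about its conditional mean. -/
noncomputable def fluctuation (f₁ f₂ : ℝ[X]) (G : SimpleGraph (Vertex n)) (u : Fin 2 → Fin 2 → ℂ)
    (a : Fin 2 → ℝ) (A B : Finset (Vertex n)) : ℝ :=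
  ‖fun i => beta u a B i - stepExp f₁ f₂ G A (fun B => beta u a B i)‖

theorem fluctuation_nonneg (A B : Finset (Vertex n)) : 0 ≤ fluctuation f₁ f₂ G u a A B :=
  norm_nonneg _

theorem norm_beta_sub_stepExp_le (A B : Finset (Vertex n)) (i : Fin 2) :
    ‖beta u a B i - stepExp f₁ f₂ G A (fun B => beta u a B i)‖ ≤ fluctuation f₁ f₂ G u a A B :=
  norm_le_pi_norm (fun i => beta u a B i - stepExp f₁ f₂ G A (fun B => beta u a B i)) i

theorem fluctuation_sq_le (A B : Finset (Vertex n)) :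
    fluctuation f₁ f₂ G u a A B ^ 2 ≤ 2 * coordBound u ^ 2 *
      ∑ k, (density B k - stepExp f₁ f₂ G A fun B => density B k) ^ 2 := by
  set d : Fin 2 → ℝ := fun k => density B k - stepExp f₁ f₂ G A fun B => density B k with hd
  have h1 : fluctuation f₁ f₂ G u a A B ≤ coordBound u * (|d 0| + |d 1|) := by
    refine (pi_norm_le_iff_of_nonneg ?_).2 fun i => ?_
    · have := coordBound_nonneg u; positivity
    · rw [beta_sub_stepExp]
      refine (norm_sum_le _ _).trans ?_
      rw [Fin.sum_univ_two, norm_mul, norm_mul, Complex.norm_real, Complex.norm_real,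
        Real.norm_eq_abs, Real.norm_eq_abs, mul_add]
      exact add_le_add
        (mul_le_mul_of_nonneg_right (norm_coordMatrix_le u i 0) (abs_nonneg _))
        (mul_le_mul_of_nonneg_right (norm_coordMatrix_le u i 1) (abs_nonneg _))
  have h2 : (|d 0| + |d 1|) ^ 2 ≤ 2 * (d 0 ^ 2 + d 1 ^ 2) := by
    rw [← sq_abs (d 0), ← sq_abs (d 1)]
    nlinarith [sq_nonneg (|d 0| - |d 1|)]
  calc _ ≤ (coordBound u * (|d 0| + |d 1|)) ^ 2 :=
        pow_le_pow_left₀ (fluctuation_nonneg A B) h1 2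
    _ = coordBound u ^ 2 * (|d 0| + |d 1|) ^ 2 := by ring
    _ ≤ coordBound u ^ 2 * (2 * (d 0 ^ 2 + d 1 ^ 2)) := by gcongr
    _ = _ := by rw [Fin.sum_univ_two]; ring

theorem sum_stepProb_mul_fluctuation_sq_le
    (hf₁ : ∀ x ∈ Set.Icc (0 : ℝ) 1, f₁.eval x ∈ Set.Icc (0 : ℝ) 1)
    (hf₂ : ∀ x ∈ Set.Icc (0 : ℝ) 1, f₂.eval x ∈ Set.Icc (0 : ℝ) 1) (hn : 0 < n)
    (A : Finset (Vertex n)) :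
    ∑ B, stepProb f₁ f₂ G A B * (√n * fluctuation f₁ f₂ G u a A B) ^ 2
      ≤ 4 * coordBound u ^ 2 := by
  have hn' : (0 : ℝ) < n := by exact_mod_cast hn
  have h0 : ∀ B, 0 ≤ stepProb f₁ f₂ G A B :=
    bernoulliWeight_nonneg (vertexProb_mem_Icc hf₁ hf₂ A)
  calc _ ≤ ∑ B, stepProb f₁ f₂ G A B * (n * (2 * coordBound u ^ 2 *
      ∑ k, (density B k - stepExp f₁ f₂ G A fun B => density B k) ^ 2)) := by
        refine Finset.sum_le_sum fun B _ => mul_le_mul_of_nonneg_left ?_ (h0 B)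
        rw [mul_pow, Real.sq_sqrt hn'.le]
        exact mul_le_mul_of_nonneg_left (fluctuation_sq_le A B) hn'.le
    _ = n * (2 * coordBound u ^ 2 * ∑ k, stepVar f₁ f₂ G A (fun B => density B k)) := by
        simp only [← sum_stepProb_mul_density_sub_sq, Fin.sum_univ_two, mul_add, Finset.mul_sum,
          Finset.sum_add_distrib]
        congr 1 <;> exact Finset.sum_congr rfl fun B _ => by ring
    _ ≤ n * (2 * coordBound u ^ 2 * ∑ k : Fin 2, 1 / (n : ℝ)) := by
        gcongr with k
        exact stepVar_density_le hf₁ hf₂ hn A k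
    _ = _ := by
        simp
        field_simp
        ring

theorem exists_coordMatrix_ne_zero (hu : LinearIndependent ℂ u) (i : Fin 2) :
    ∃ k, coordMatrix u i k ≠ 0 := by
  by_contra! h
  have hunit : IsUnit (Matrix.of fun k i => u i k : Matrix (Fin 2) (Fin 2) ℂ) :=
    Matrix.linearIndependent_cols_iff_isUnit.1 hu
  have h1 : coordMatrix u * (Matrix.of fun k i => u i k) = 1 :=
    Matrix.nonsing_inv_mul _ ((Matrix.isUnit_iff_isUnit_det _).1 hunit)
  have h2 := congrFun (congrFun h1 i) i
  rw [Matrix.mul_apply, Matrix.one_apply_eq] at h2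
  simp [h] at h2

/-- A real linear functional below the modulus of a given coordinate. -/
theorem exists_functional_le_norm_eigenCoord (hu : LinearIndependent ℂ u) (i : Fin 2) :
    ∃ c : Fin 2 → ℝ, (∃ k, c k ≠ 0) ∧
      ∀ (a x : Fin 2 → ℝ), |∑ k, c k * (x k - a k)| ≤ ‖eigenCoord u a x i‖ := by
  obtain ⟨k, hk⟩ := exists_coordMatrix_ne_zero hu i
  -- A row of the invertible matrix U is nonzero, so its real or its imaginary part is a nonzero
  -- real functional, and both are bounded by the modulus.
  by_cases h : (coordMatrix u i k).re = 0
  · refine ⟨fun k => (coordMatrix u i k).im, ⟨k, fun h' => hk (Complex.ext h h')⟩, fun a x => ?_⟩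
    refine le_trans (le_of_eq ?_) (Complex.abs_im_le_norm _)
    simp only [eigenCoord_apply, Complex.im_sum, Complex.im_mul_ofReal]
  · refine ⟨fun k => (coordMatrix u i k).re, ⟨k, h⟩, fun a x => ?_⟩
    refine le_trans (le_of_eq ?_) (Complex.abs_re_le_norm _)
    simp only [eigenCoord_apply, Complex.re_sum, Complex.re_mul_ofReal]

open Classical in
/-- From any configuration with variances of order `1/n`, each coordinate of `√n β'` exceeds a
given constant with probability bounded below, even together with a bound on the fluctuation. -/
theorem exists_jump_probability (hf₁ : ∀ x ∈ Set.Icc (0 : ℝ) 1, f₁.eval x ∈ Set.Icc (0 : ℝ) 1)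
    (hf₂ : ∀ x ∈ Set.Icc (0 : ℝ) 1, f₂.eval x ∈ Set.Icc (0 : ℝ) 1)
    (hu : LinearIndependent ℂ u) (a : Fin 2 → ℝ) (i : Fin 2) {c₀ : ℝ} (hc₀ : 0 < c₀) (H : ℝ) :
    ∃ c M : ℝ, 0 < c ∧ 0 ≤ M ∧ ∃ N : ℕ, ∀ n ≥ N, ∀ (G : SimpleGraph (Vertex n))
      (A : Finset (Vertex n)), (∀ k, c₀ / n ≤ stepVar f₁ f₂ G A fun B => density B k) →
      c ≤ ∑ B, if H ≤ √n * ‖beta u a B i‖ ∧ √n * fluctuation f₁ f₂ G u a A B ≤ M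
        then stepProb f₁ f₂ G A B else 0 := by
  obtain ⟨d, ⟨k₀, hk₀⟩, hd⟩ := exists_functional_le_norm_eigenCoord hu i
  set s : ℝ := d k₀ ^ 2 * c₀ with hs
  have hs0 : 0 < s := by positivity
  set S : ℝ := ∑ k, d k ^ 2 with hS
  have hdS : ∀ k, |d k| ≤ √S := fun k => Real.abs_le_sqrt
    (Finset.single_le_sum (f := fun k => d k ^ 2) (fun k _ => sq_nonneg _) (Finset.mem_univ k))
  -- The anticoncentration bound needs a nonnegative height and `t ≥ 1`; `s` and `S` bound the
  -- variance of the functional scaled by √n.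
  set H' : ℝ := max H 0 with hH'
  set t : ℝ := max 1 (8 * (H' + 1) / s) with ht
  have ht1 : 1 ≤ t := le_max_left _ _
  have hts : 8 * (H' + 1) ≤ t * s := (div_le_iff₀ hs0).1 (le_max_right _ _)
  set c₁ : ℝ := Real.exp (-(4 * t ^ 2 * S)) with hc₁
  have hc₁0 : 0 < c₁ := Real.exp_pos _
  set K : ℝ := 4 * coordBound u ^ 2 with hK
  have hK0 : 0 ≤ K := by positivity
  set M : ℝ := √(2 * K / c₁) + 1 with hM
  have hM0 : 0 < M := by positivity
  have hKM : K / M ^ 2 ≤ c₁ / 2 := by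
    rw [div_le_div_iff₀ (by positivity) (by norm_num)]
    have h1 : 2 * K / c₁ ≤ M ^ 2 := by
      rw [hM]
      nlinarith [Real.sq_sqrt (show 0 ≤ 2 * K / c₁ by positivity), Real.sqrt_nonneg (2 * K / c₁)]
    rw [div_le_iff₀ hc₁0] at h1
    linarith
  -- Anticoncentration gives probability `c₁`, and by Chebyshev the noise exceeds `M` with
  -- probability at most `c₁ / 2`. The weights have size at most `√S / √n`, so this bound on `n`
  -- makes them small enough for the exponential estimates.
  refine ⟨c₁ / 2, M, by positivity, hM0.le, ⌈(2 * t * √S) ^ 2⌉₊ + 1, fun n hn G A hvar => ?_⟩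
  have hn0 : 0 < n := by omega
  have hn' : (0 : ℝ) < n := by exact_mod_cast hn0
  have hsn : 0 < √(n : ℝ) := Real.sqrt_pos.2 hn'
  have hnt : 2 * t * √S ≤ √n := by
    refine Real.le_sqrt_of_sq_le ?_
    refine (Nat.le_ceil _).trans ?_
    exact_mod_cast (Nat.le_succ _).trans hn
  have hπ := vertexProb_mem_Icc (G := G) hf₁ hf₂ A
  have hP : ∀ B, 0 ≤ stepProb f₁ f₂ G A B := bernoulliWeight_nonneg hπ
  set m : ℝ := ∑ k, d k * ((stepExp f₁ f₂ G A fun B => density B k) - a k) with hm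
  -- The fluctuation is taken in the direction of the conditional mean, which then can only help: no
  -- information on the drift is needed.
  obtain ⟨σ, hσ, hσm⟩ : ∃ σ : ℝ, |σ| = 1 ∧ 0 ≤ σ * m := by
    rcases le_total 0 m with h | h
    · exact ⟨1, by simp, by simpa using h⟩
    · exact ⟨-1, by simp, by linarith⟩
  set w : Vertex n → ℝ := fun v => (√n * σ * d v.1) / n with hw
  have hVar : bernoulliVar (vertexProb f₁ f₂ G A) w
      = n * ∑ k, d k ^ 2 * stepVar f₁ f₂ G A (fun B => density B k) := by
    rw [hw, bernoulliVar_eq_sum_stepVar A (fun k => √n * σ * d k), Finset.mul_sum]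
    refine Finset.sum_congr rfl fun k _ => ?_
    rw [mul_pow, mul_pow, Real.sq_sqrt hn'.le, ← sq_abs σ, hσ]
    ring
  have hv0 : ∀ k, 0 ≤ stepVar f₁ f₂ G A (fun B => density B k) :=
    fun k => le_trans (by positivity) (hvar k)
  have hlow : s ≤ bernoulliVar (vertexProb f₁ f₂ G A) w := by
    rw [hVar]
    have h1 : d k₀ ^ 2 * stepVar f₁ f₂ G A (fun B => density B k₀)
        ≤ ∑ k, d k ^ 2 * stepVar f₁ f₂ G A (fun B => density B k) :=
      Finset.single_le_sum (f := fun k => d k ^ 2 * stepVar f₁ f₂ G A (fun B => density B k))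
        (fun k _ => mul_nonneg (sq_nonneg _) (hv0 k)) (Finset.mem_univ k₀)
    calc s = n * (d k₀ ^ 2 * (c₀ / n)) := by rw [hs]; field_simp
      _ ≤ n * (d k₀ ^ 2 * stepVar f₁ f₂ G A (fun B => density B k₀)) := by
          gcongr
          exact hvar k₀
      _ ≤ _ := by gcongr
  have hup : bernoulliVar (vertexProb f₁ f₂ G A) w ≤ S := by
    rw [hVar]
    calc _ ≤ (n : ℝ) * ∑ k, d k ^ 2 * (1 / (n : ℝ)) := by
          gcongr with k
          exact stepVar_density_le hf₁ hf₂ hn0 A k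
      _ = S := by
          rw [← Finset.sum_mul]
          field_simp
          exact hS.symm
  have hsmall : ∀ v, |2 * t * w v| ≤ 1 := by
    intro v
    rw [hw, abs_mul, abs_div, abs_mul, abs_mul, abs_mul, hσ, abs_two, abs_of_pos hsn,
      abs_of_pos hn', abs_of_pos (by linarith : 0 < t), mul_div_assoc', div_le_one hn', mul_one]
    calc 2 * t * (√n * |d v.1|) ≤ 2 * t * (√n * √S) := by gcongr; exact hdS v.1
      _ = √n * (2 * t * √S) := by ring
      _ ≤ √n * √n := by gcongr
      _ = n := Real.mul_self_sqrt hn'.le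
  have hanti := bernoulli_anticoncentration hπ (le_max_right H 0) ht1 hts hlow hup hsmall
  have hcentred : ∀ B, centredSum (vertexProb f₁ f₂ G A) w B ≤ √n * ‖beta u a B i‖ := by
    intro B
    rw [hw, ← sum_mul_density_sub_stepExp A B (fun k => √n * σ * d k)]
    have h1 : ∑ k, √n * σ * d k * (density B k - stepExp f₁ f₂ G A fun B => density B k)
        = √n * (σ * (∑ k, d k * (density B k - a k)) - σ * m) := by
      rw [hm]
      simp only [Fin.sum_univ_two]
      ring
    rw [h1]
    refine mul_le_mul_of_nonneg_left ?_ hsn.le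
    have h2 : σ * (∑ k, d k * (density B k - a k)) ≤ |∑ k, d k * (density B k - a k)| := by
      refine (le_abs_self _).trans ?_
      rw [abs_mul, hσ, one_mul]
    have h3 := hd a (density B)
    rw [beta]
    linarith
  have hcheb : ∑ B, (if M < √n * fluctuation f₁ f₂ G u a A B then stepProb f₁ f₂ G A B else 0)
      ≤ c₁ / 2 := by
    refine le_trans ?_ hKM
    rw [le_div_iff₀ (by positivity), Finset.sum_mul]
    refine (Finset.sum_le_sum fun B _ => ?_).trans
      (sum_stepProb_mul_fluctuation_sq_le (G := G) (u := u) (a := a) hf₁ hf₂ hn0 A)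
    split_ifs with h
    · exact mul_le_mul_of_nonneg_left (pow_le_pow_left₀ hM0.le h.le 2) (hP B)
    · rw [zero_mul]; exact mul_nonneg (hP B) (sq_nonneg _)
  have hsum : ∑ B, (if H' ≤ centredSum (vertexProb f₁ f₂ G A) w B
        then bernoulliWeight (vertexProb f₁ f₂ G A) B else 0)
      ≤ (∑ B, if H ≤ √n * ‖beta u a B i‖ ∧ √n * fluctuation f₁ f₂ G u a A B ≤ M
          then stepProb f₁ f₂ G A B else 0)
        + ∑ B, (if M < √n * fluctuation f₁ f₂ G u a A B then stepProb f₁ f₂ G A B else 0) := by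
    rw [← Finset.sum_add_distrib]
    refine Finset.sum_le_sum fun B _ => ?_
    have hPB := hP B
    rw [stepProb_eq_bernoulliWeight] at hPB ⊢
    by_cases h1 : H' ≤ centredSum (vertexProb f₁ f₂ G A) w B
    · have h2 : H ≤ √n * ‖beta u a B i‖ := (le_max_left H 0).trans (h1.trans (hcentred B))
      by_cases h3 : M < √n * fluctuation f₁ f₂ G u a A B
      · rw [if_pos h1, if_pos h3]
        split_ifs <;> linarith
      · rw [if_pos h1, if_pos ⟨h2, not_lt.1 h3⟩, if_neg h3, add_zero]
    · rw [if_neg h1]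
      split_ifs <;> linarith
  linarith

end Beta

/-! ### From drift conditions to escape in logarithmic time. -/

section Escape

open MeasureTheory Filter

/-- The 2 in `K` makes `θ^T` at most `n⁻² / θ`, which beats the factor `n`. Halving the exponent
`min 1 c` leaves room to absorb the constants and the logarithm. -/
theorem exists_geometric_add_log_mul_rpow_le {θ c D K : ℝ} (hθ : 0 < θ) (hθ1 : θ < 1) (hc : 0 < c)
    (hD : 0 ≤ D) (hK : K = 2 / (-Real.log θ)) :
    ∃ N : ℕ, ∀ n ≥ N, θ ^ ⌊K * Real.log n⌋₊ * (D * n) + ⌊K * Real.log n⌋₊ * (2 * (n : ℝ) ^ (-c))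
      ≤ (n : ℝ) ^ (-(min 1 c / 2)) := by
  have hlog : Real.log θ < 0 := Real.log_neg hθ hθ1
  have hK0 : 0 < K := by rw [hK]; exact div_pos (by norm_num) (by linarith)
  set κ : ℝ := min 1 c / 2 with hκ
  have hmin : 0 < min 1 c := lt_min one_pos hc
  have hκ0 : 0 < κ := by positivity
  have h1 : ∀ᶠ n : ℕ in atTop, D / θ ≤ 1 / 2 * (n : ℝ) ^ κ := by
    have := ((tendsto_rpow_atTop hκ0).comp tendsto_natCast_atTop_atTop).const_mul_atTop
      (by norm_num : (0 : ℝ) < 1 / 2)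
    exact this.eventually_ge_atTop (D / θ)
  have h2 : ∀ᶠ n : ℕ in atTop, 2 * K * Real.log n ≤ 1 / 2 * (n : ℝ) ^ κ := by
    have := ((isLittleO_log_rpow_atTop hκ0).comp_tendsto tendsto_natCast_atTop_atTop).def
      (show 0 < 1 / (4 * K) by positivity)
    filter_upwards [this] with n hn
    simp only [Function.comp, Real.norm_eq_abs] at hn
    rw [abs_of_nonneg (Real.rpow_nonneg (Nat.cast_nonneg n) κ)] at hn
    have h3 := (le_abs_self _).trans hn
    calc 2 * K * Real.log n ≤ 2 * K * (1 / (4 * K) * (n : ℝ) ^ κ) := by gcongr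
      _ = _ := by field_simp; norm_num
  obtain ⟨N, hN⟩ := eventually_atTop.1 (h1.and h2)
  refine ⟨max N 1, fun n hn => ?_⟩
  obtain ⟨hn1, hn2⟩ := hN n ((le_max_left _ _).trans hn)
  have hn0 : 1 ≤ n := (le_max_right _ _).trans hn
  have hn' : (1 : ℝ) ≤ n := by exact_mod_cast hn0
  have hnp : (0 : ℝ) < n := by linarith
  have hln : 0 ≤ Real.log n := Real.log_nonneg hn'
  set T := ⌊K * Real.log n⌋₊ with hT
  have hT1 : (T : ℝ) ≤ K * Real.log n := Nat.floor_le (by positivity)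
  have hT2 : K * Real.log n < T + 1 := Nat.lt_floor_add_one _
  have hpow : θ ^ T * n ≤ 1 / θ * (n : ℝ) ^ (-(1 : ℝ)) := by
    have e1 : θ ^ T = Real.exp (Real.log θ * T) := by
      rw [← Real.rpow_natCast, Real.rpow_def_of_pos hθ]
    have e2 : 1 / θ = Real.exp (-Real.log θ) := by rw [Real.exp_neg, Real.exp_log hθ, one_div]
    have e3 : (n : ℝ) ^ (-(1 : ℝ)) = Real.exp (-Real.log n) := by
      rw [Real.rpow_def_of_pos hnp]; ring_nf
    have e4 : Real.exp (Real.log θ * T) * n = Real.exp (Real.log θ * T + Real.log n) := by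
      rw [Real.exp_add, Real.exp_log hnp]
    rw [e3, e1, e2, e4, ← Real.exp_add]
    refine Real.exp_le_exp.2 ?_
    have h5 : (-Real.log θ) * (K * Real.log n) = 2 * Real.log n := by
      have : Real.log θ ≠ 0 := hlog.ne
      rw [hK]; field_simp
    have h6 : (-Real.log θ) * (K * Real.log n) ≤ (-Real.log θ) * (T + 1) :=
      mul_le_mul_of_nonneg_left hT2.le (by linarith)
    linarith
  have hr1 : (n : ℝ) ^ (-(1 : ℝ)) ≤ (n : ℝ) ^ (-(2 * κ)) :=
    Real.rpow_le_rpow_of_exponent_le hn' (by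
      have : min 1 c ≤ 1 := min_le_left _ _
      rw [hκ]; linarith)
  have hrc : (n : ℝ) ^ (-c) ≤ (n : ℝ) ^ (-(2 * κ)) :=
    Real.rpow_le_rpow_of_exponent_le hn' (by
      have : min 1 c ≤ c := min_le_right _ _
      rw [hκ]; linarith)
  have hsplit : (n : ℝ) ^ κ * (n : ℝ) ^ (-(2 * κ)) = (n : ℝ) ^ (-κ) := by
    rw [← Real.rpow_add hnp]; ring_nf
  have hpos : 0 ≤ (n : ℝ) ^ (-(2 * κ)) := Real.rpow_nonneg hnp.le _
  calc θ ^ T * (D * n) + T * (2 * (n : ℝ) ^ (-c))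
      = D * (θ ^ T * n) + 2 * T * (n : ℝ) ^ (-c) := by ring
    _ ≤ D * (1 / θ * (n : ℝ) ^ (-(2 * κ))) + 2 * (K * Real.log n) * (n : ℝ) ^ (-(2 * κ)) := by
        have := hpow.trans (mul_le_mul_of_nonneg_left hr1 (by positivity))
        gcongr
    _ = (D / θ + 2 * K * Real.log n) * (n : ℝ) ^ (-(2 * κ)) := by ring
    _ ≤ (n : ℝ) ^ κ * (n : ℝ) ^ (-(2 * κ)) := by
        gcongr
        linarith
    _ = _ := hsplit

variable {f₁ f₂ : ℝ[X]} {u : Fin 2 → Fin 2 → ℂ} {a : Fin 2 → ℝ} {lam : Fin 2 → ℂ}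

/-- In the region `‖β‖ ≤ ε`, the coordinate `ξ` of `β` expands and the coordinate `υ` contracts, up
to errors of order `1/√n`, the fluctuations, and a coupling of strength `δ`; moreover, the
variances are of order `1/n` and the nonexpanding coordinates stay small. -/
structure HasEscapeDrift (f₁ f₂ : ℝ[X]) (a : Fin 2 → ℝ) (u : Fin 2 → Fin 2 → ℂ) (lam : Fin 2 → ℂ)
    (l ρ δ C c₀ ε c : ℝ) (ξ υ : (Fin 2 → ℂ) → ℝ) {n : ℕ} (G : SimpleGraph (Vertex n)) : Prop where
  var_ge : ∀ A : Finset (Vertex n), ‖beta u a A‖ ≤ ε → ∀ k,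
    c₀ / n ≤ stepVar f₁ f₂ G A fun B => density B k
  expand : ∀ A : Finset (Vertex n), ‖beta u a A‖ ≤ ε → ∀ B,
    l * ξ (beta u a A) - δ * υ (beta u a A) - C / √n - fluctuation f₁ f₂ G u a A B
      ≤ ξ (beta u a B)
  contract : ∀ A : Finset (Vertex n), ‖beta u a A‖ ≤ ε → ∀ B,
    υ (beta u a B)
      ≤ ρ * υ (beta u a A) + δ * ξ (beta u a A) + C / √n + fluctuation f₁ f₂ G u a A B
  stable : ∀ A : Finset (Vertex n), ‖beta u a A‖ ≤ ε → ∀ j, ‖lam j‖ ≤ 1 →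
    1 - (n : ℝ) ^ (-c) ≤ stepPr f₁ f₂ G A fun B => ‖beta u a B j‖ ≤ ε

open Classical in
theorem sum_stepProb_not_le {n : ℕ} {G : SimpleGraph (Vertex n)}
    (hf₁ : ∀ x ∈ Set.Icc (0 : ℝ) 1, f₁.eval x ∈ Set.Icc (0 : ℝ) 1)
    (hf₂ : ∀ x ∈ Set.Icc (0 : ℝ) 1, f₂.eval x ∈ Set.Icc (0 : ℝ) 1) {A : Finset (Vertex n)}
    {r ε : ℝ} (hr : 0 ≤ r)
    (h : ∀ j, ‖lam j‖ ≤ 1 → 1 - r ≤ stepPr f₁ f₂ G A fun B => ‖beta u a B j‖ ≤ ε) :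
    ∑ B, (if ¬ ∀ j, ‖lam j‖ ≤ 1 → ‖beta u a B j‖ ≤ ε then stepProb f₁ f₂ G A B else 0)
      ≤ 2 * r := by
  have hP : ∀ B, 0 ≤ stepProb f₁ f₂ G A B :=
    bernoulliWeight_nonneg (vertexProb_mem_Icc hf₁ hf₂ A)
  have hj : ∀ j, ∑ B, (if ‖lam j‖ ≤ 1 ∧ ε < ‖beta u a B j‖ then stepProb f₁ f₂ G A B else 0)
      ≤ r := by
    intro j
    by_cases hl : ‖lam j‖ ≤ 1
    · have h1 := h j hl
      rw [stepPr] at h1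
      have h2 : (∑ B, if ‖beta u a B j‖ ≤ ε then stepProb f₁ f₂ G A B else 0)
          + ∑ B, (if ‖lam j‖ ≤ 1 ∧ ε < ‖beta u a B j‖ then stepProb f₁ f₂ G A B else 0) = 1 := by
        rw [← Finset.sum_add_distrib]
        refine (Finset.sum_congr rfl fun B _ => ?_).trans
          (sum_stepProb (f₁ := f₁) (f₂ := f₂) (G := G) A)
        by_cases hB : ‖beta u a B j‖ ≤ ε
        · simp [hB, not_lt.2 hB]
        · simp [hB, hl, not_le.1 hB]
      -- The two sums agree up to the choice of decidability instance.
      have h3 : (∑ B, if ‖beta u a B j‖ ≤ ε then stepProb f₁ f₂ G A B else 0)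
          = ∑ B, @ite ℝ (‖beta u a B j‖ ≤ ε) (propDecidable _) (stepProb f₁ f₂ G A B) 0 :=
        Finset.sum_congr rfl fun B _ => by congr
      linarith
    · refine le_trans (Finset.sum_nonpos fun B _ => ?_) hr
      rw [if_neg fun hh => hl hh.1]
  calc _ ≤ ∑ B, ∑ j, (if ‖lam j‖ ≤ 1 ∧ ε < ‖beta u a B j‖ then stepProb f₁ f₂ G A B else 0) := by
        refine Finset.sum_le_sum fun B _ => ?_
        have hnn : ∀ j ∈ Finset.univ, 0 ≤
            (if ‖lam j‖ ≤ 1 ∧ ε < ‖beta u a B j‖ then stepProb f₁ f₂ G A B else 0) := by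
          intro j _
          split_ifs
          exacts [hP B, le_rfl]
        split_ifs with hB
        · exact Finset.sum_nonneg hnn
        · push Not at hB
          obtain ⟨j, hj1, hj2⟩ := hB
          have := Finset.single_le_sum hnn (Finset.mem_univ j)
          rwa [if_pos ⟨hj1, hj2⟩] at this
    _ = ∑ j, ∑ B, (if ‖lam j‖ ≤ 1 ∧ ε < ‖beta u a B j‖ then stepProb f₁ f₂ G A B else 0) :=
        Finset.sum_comm
    _ ≤ ∑ _j : Fin 2, r := Finset.sum_le_sum fun j _ => hj j
    _ = 2 * r := by simp

theorem IsVotingProcess.hasChainLaw {n : ℕ} {G : SimpleGraph (Vertex n)} {A₀ : Finset (Vertex n)}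
    {Ω : Type*} [MeasurableSpace Ω] {μ : Measure Ω} {X : ℕ → Ω → Finset (Vertex n)}
    (h : IsVotingProcess f₁ f₂ G A₀ μ X) : HasChainLaw (stepProb f₁ f₂ G) A₀ μ X :=
  h.law

/-- The potential is applied to `√n ξ` and `√n υ`; as `ξ` dominates `|β_i|`, a jump of `β_i` is a
jump of `ξ`. The admissible coupling `δ` depends on `l`, `ρ`, `C`, `c₀` but not on the radius `ε`,
so the neighbourhood can later be shrunk until the nonlinear terms are below `δ`. -/
theorem escapesWhp_of_hasEscapeDrift
    (hf₁ : ∀ x ∈ Set.Icc (0 : ℝ) 1, f₁.eval x ∈ Set.Icc (0 : ℝ) 1)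
    (hf₂ : ∀ x ∈ Set.Icc (0 : ℝ) 1, f₂.eval x ∈ Set.Icc (0 : ℝ) 1)
    (hu : LinearIndependent ℂ u) (a : Fin 2 → ℝ) (i : Fin 2) {l ρ C c₀ : ℝ} (hl : 1 < l)
    (hl2 : l ≤ 2) (hρ1 : ρ < 1) (hC : 0 ≤ C) (hc₀ : 0 < c₀) :
    ∃ δ : ℝ, 0 < δ ∧ ∀ (𝒢 : ∀ n : ℕ, Set (SimpleGraph (Vertex n))) (ε c : ℝ)
      (ξ υ : (Fin 2 → ℂ) → ℝ), 0 < ε → 0 < c → (∀ β, ‖β i‖ ≤ ξ β) → (∀ β, ξ β ≤ ‖β‖) →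
      (∀ β, 0 ≤ υ β) → (∀ β, υ β ≤ ‖β‖) →
      (∃ N : ℕ, ∀ n ≥ N, ∀ G ∈ 𝒢 n, HasEscapeDrift f₁ f₂ a u lam l ρ δ C c₀ ε c ξ υ G) →
      EscapesWhp.{w} f₁ f₂ a u lam 𝒢 := by
  classical
  choose cJ M hcJ hM NJ hNJ using exists_jump_probability hf₁ hf₂ hu a i hc₀
  obtain ⟨δ, h, b, η, θ, H, hδ, hh, hb, hη, hθ, hθ1, -, hΨ⟩ :=
    exists_escapePotential_contraction hl hl2 hρ1 hC
      (show 0 ≤ 4 * coordBound u ^ 2 by positivity) cJ M hcJ hM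
  refine ⟨δ, hδ, fun 𝒢 ε c ξ υ hε hc hξi hξ hυ0 hυ ⟨N, hN⟩ => ?_⟩
  have hlog : Real.log θ < 0 := Real.log_neg hθ hθ1
  -- The initial potential is at most `√n (1 + b ε)` and its minimum on the region is at least `h /
  -- (√n (h + ε))`; their ratio gives this constant times `n`.
  obtain ⟨N', hN'⟩ := exists_geometric_add_log_mul_rpow_le hθ hθ1 hc
    (show 0 ≤ (1 + b * ε) * ((h + ε) / h) by positivity) rfl
  set K : ℝ := 2 / (-Real.log θ) with hK
  have hK0 : 0 < K := by rw [hK]; exact div_pos (by norm_num) (by linarith)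
  refine ⟨ε, hε, K, hK0, min 1 c / 2, by have := lt_min one_pos hc; positivity,
    max (max N N') (max (NJ H) 1), ?_⟩
  intro n hn G hG A₀ hA₀ Ω _ μ _ X hX
  have hnN : N ≤ n := ((le_max_left _ _).trans (le_max_left _ _)).trans hn
  have hnN' : N' ≤ n := ((le_max_right _ _).trans (le_max_left _ _)).trans hn
  have hnJ : NJ H ≤ n := ((le_max_left _ _).trans (le_max_right _ _)).trans hn
  have hn1 : 1 ≤ n := ((le_max_right _ _).trans (le_max_right _ _)).trans hn
  have hn' : (1 : ℝ) ≤ n := by exact_mod_cast hn1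
  have hs1 : 1 ≤ √(n : ℝ) := Real.one_le_sqrt.2 hn'
  have hs0 : 0 < √(n : ℝ) := by linarith
  have hD := hN n hnN G hG
  have hP : ∀ A B, 0 ≤ stepProb f₁ f₂ G A B := fun A =>
    bernoulliWeight_nonneg (vertexProb_mem_Icc hf₁ hf₂ A)
  have hξ0 : ∀ β, 0 ≤ ξ β := fun β => (norm_nonneg _).trans (hξi β)
  set Ψ : Finset (Vertex n) → ℝ := fun A =>
    escapePotential h b η (√n * ξ (beta u a A)) (√n * υ (beta u a A)) with hΨdef
  have hcancel : √(n : ℝ) * (C / √n) = C := by field_simp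
  have hdec : ∀ A, ‖beta u a A‖ ≤ ε → ∑ B, stepProb f₁ f₂ G A B * Ψ B ≤ θ * Ψ A := by
    intro A hA
    refine hΨ (stepProb f₁ f₂ G A) (fun B => √n * ξ (beta u a B)) (fun B => √n * υ (beta u a B))
      (fun B => √n * fluctuation f₁ f₂ G u a A B) _ _ (hP A) (sum_stepProb A)
      (mul_nonneg hs0.le (hξ0 _)) (mul_nonneg hs0.le (hυ0 _))
      (fun B => mul_nonneg hs0.le (hυ0 _)) (fun B => mul_nonneg hs0.le (fluctuation_nonneg A B))
      (fun B => ?_) (fun B => ?_) (sum_stepProb_mul_fluctuation_sq_le hf₁ hf₂ hn1 A) ?_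
    · have := mul_le_mul_of_nonneg_left (hD.expand A hA B) hs0.le
      simp only [mul_sub, hcancel] at this
      linarith
    · have := mul_le_mul_of_nonneg_left (hD.contract A hA B) hs0.le
      simp only [mul_add, hcancel] at this
      linarith
    · refine (hNJ H n hnJ G A (hD.var_ge A hA)).trans (Finset.sum_le_sum fun B _ => ?_)
      by_cases h1 : H ≤ √n * ‖beta u a B i‖ ∧ √n * fluctuation f₁ f₂ G u a A B ≤ M H
      · rw [if_pos h1, if_pos ⟨h1.1.trans (mul_le_mul_of_nonneg_left (hξi _) hs0.le), h1.2⟩]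
      · rw [if_neg h1]
        split_ifs
        exacts [hP A B, le_rfl]
  have hΨ0 : ∀ A, 0 ≤ Ψ A := fun A => escapePotential_nonneg hh hb (mul_nonneg hs0.le (hυ0 _))
  have hΨm : ∀ A, ‖beta u a A‖ ≤ ε → h / (h + √n * ε) ≤ Ψ A := by
    intro A hA
    refine le_trans ?_ (div_add_le_escapePotential hh hb hη (mul_nonneg hs0.le (hξ0 _))
      (mul_nonneg hs0.le (hυ0 _)))
    have : √n * ξ (beta u a A) ≤ √n * ε := mul_le_mul_of_nonneg_left ((hξ _).trans hA) hs0.le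
    exact div_le_div_of_nonneg_left hh.le
      (by have := mul_nonneg hs0.le (hξ0 (beta u a A)); linarith) (by linarith)
  have hr0 : 0 ≤ (n : ℝ) ^ (-c) := Real.rpow_nonneg (by linarith) _
  set T := ⌊K * Real.log n⌋₊ with hT
  have hexit := one_sub_le_measureReal_exit (p := stepProb f₁ f₂ G) hX.measurable hX.hasChainLaw hP
    (R := fun A => ‖beta u a A‖ ≤ ε) (D := fun B => ∀ j, ‖lam j‖ ≤ 1 → ‖beta u a B j‖ ≤ ε)
    (ε := 2 * (n : ℝ) ^ (-c)) hθ.le (show 0 < h / (h + √n * ε) by positivity) (by positivity)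
    hΨ0 hΨm hdec
    (fun A hA => by
      convert sum_stepProb_not_le hf₁ hf₂ hr0 (hD.stable A hA)) hA₀ T
  have hstart : θ ^ T * Ψ A₀ / (h / (h + √n * ε))
      ≤ θ ^ T * ((1 + b * ε) * ((h + ε) / h) * n) := by
    have h1 : Ψ A₀ ≤ √n * (1 + b * ε) := by
      refine (escapePotential_le hh hb (mul_nonneg hs0.le (hυ0 _))).trans ?_
      have : b * (√n * υ (beta u a A₀)) ≤ b * (√n * ε) := by
        gcongr
        exact (hυ _).trans hA₀
      linarith
    have h2 : h + √n * ε ≤ √n * (h + ε) := by nlinarith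
    calc θ ^ T * Ψ A₀ / (h / (h + √n * ε)) = θ ^ T * (Ψ A₀ * ((h + √n * ε) / h)) := by
          field_simp
      _ ≤ θ ^ T * ((√n * (1 + b * ε)) * (√n * (h + ε) / h)) := by gcongr
      _ = θ ^ T * ((1 + b * ε) * ((h + ε) / h) * (√n * √n)) := by ring
      _ = _ := by rw [Real.mul_self_sqrt (by linarith)]
  have hfinal := hN' n hnN'
  refine le_trans ?_ (hexit.trans (measureReal_mono ?_))
  · linarith
  · rintro ω ⟨τ, hτ, hR, hDτ⟩
    refine ⟨τ, ?_, not_le.1 hR, hDτ⟩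
    have : (T : ℝ) ≤ K * Real.log n := Nat.floor_le (mul_nonneg hK0.le (Real.log_nonneg hn'))
    exact le_trans (by exact_mod_cast hτ) this

end Escape

/-! ### The induced dynamical system near its fixed point, in eigencoordinates. -/

section Linearization

variable {f₁ f₂ : ℝ[X]} {u : Fin 2 → Fin 2 → ℂ} {a : Fin 2 → ℝ} {lam : Fin 2 → ℂ}

theorem differentiable_inducedMap_apply (f₁ f₂ : ℝ[X]) (r : ℝ) (i : Fin 2) :
    Differentiable ℝ fun x => inducedMap f₁ f₂ r x i := by
  have h1 : Differentiable ℝ fun x : Fin 2 → ℝ => (x i + r * x i.rev) / (1 + r) := by fun_prop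
  have h2 := f₁.differentiable.comp h1
  have h3 := f₂.differentiable.comp h1
  have h4 : Differentiable ℝ fun x : Fin 2 → ℝ => x i := by fun_prop
  exact (h4.mul h2).add (((differentiable_const 1).sub h4).mul h3)

theorem jacobian_apply_eq_fderiv {H : (Fin 2 → ℝ) → Fin 2 → ℝ} (i j : Fin 2)
    (hH : DifferentiableAt ℝ (fun x => H x i) a) :
    jacobian H a i j = fderiv ℝ (fun x => H x i) a (Pi.single j 1) := by
  have h1 : HasDerivAt (fun x : ℝ => Function.update a j x) (Pi.single j 1) (a j) :=
    hasDerivAt_update a j (a j)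
  have h2 : HasFDerivAt (fun x => H x i) (fderiv ℝ (fun x => H x i) a)
      (Function.update a j (a j)) := by
    rw [Function.update_eq_self]
    exact hH.hasFDerivAt
  exact (h2.comp_hasDerivAt (a j) h1).deriv

theorem exists_abs_sub_sum_jacobian_le {H : (Fin 2 → ℝ) → Fin 2 → ℝ}
    (hH : ∀ i, DifferentiableAt ℝ (fun x => H x i) a) {δ : ℝ} (hδ : 0 < δ) :
    ∃ ε > 0, ∀ x, ‖x - a‖ < ε → ∀ i,
      |H x i - H a i - ∑ j, jacobian H a i j * (x j - a j)| ≤ δ * ‖x - a‖ := by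
  have h : ∀ i, ∀ᶠ x in nhds a,
      |H x i - H a i - ∑ j, jacobian H a i j * (x j - a j)| ≤ δ * ‖x - a‖ := by
    intro i
    filter_upwards [(hH i).hasFDerivAt.isLittleO.def hδ] with x hx
    have e : fderiv ℝ (fun x => H x i) a (x - a) = ∑ j, jacobian H a i j * (x j - a j) := by
      conv_lhs => rw [pi_eq_sum_univ' (x - a)]
      rw [map_sum]
      refine Finset.sum_congr rfl fun j _ => ?_
      rw [map_smul, smul_eq_mul, jacobian_apply_eq_fderiv i j (hH i), mul_comm, Pi.sub_apply]
    rw [e, Real.norm_eq_abs] at hx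
    exact hx
  obtain ⟨ε, hε, h'⟩ := Metric.eventually_nhds_iff.1 (Filter.eventually_all.2 h)
  exact ⟨ε, hε, fun x hx => h' (by rwa [dist_eq_norm])⟩

theorem isUnit_det_of_linearIndependent (hu : LinearIndependent ℂ u) :
    IsUnit (Matrix.of fun k i => u i k : Matrix (Fin 2) (Fin 2) ℂ).det :=
  (Matrix.isUnit_iff_isUnit_det _).1 (Matrix.linearIndependent_cols_iff_isUnit.1 hu)

/-- The rows of U are left eigenvectors: `J P = P Λ` for `P = U⁻¹` gives `U J = Λ U`. -/
theorem sum_coordMatrix_mul (hu : LinearIndependent ℂ u) {J : Matrix (Fin 2) (Fin 2) ℂ}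
    (heig : ∀ i, J.mulVec (u i) = lam i • u i) (i j : Fin 2) :
    ∑ k, coordMatrix u i k * J k j = lam i * coordMatrix u i j := by
  set P : Matrix (Fin 2) (Fin 2) ℂ := Matrix.of fun k i => u i k with hP
  have hdet := isUnit_det_of_linearIndependent hu
  have h1 : J * P = P * Matrix.diagonal lam := by
    ext k i
    have := congrFun (heig i) k
    rw [Matrix.mul_diagonal]
    simpa [Matrix.mul_apply, Matrix.mulVec, dotProduct, hP, mul_comm] using this
  have h2 : P⁻¹ * J = Matrix.diagonal lam * P⁻¹ := by
    calc P⁻¹ * J = P⁻¹ * J * (P * P⁻¹) := by rw [Matrix.mul_nonsing_inv _ hdet, mul_one]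
      _ = P⁻¹ * (J * P) * P⁻¹ := by simp only [mul_assoc]
      _ = P⁻¹ * P * (Matrix.diagonal lam * P⁻¹) := by rw [h1]; simp only [mul_assoc]
      _ = _ := by rw [Matrix.nonsing_inv_mul _ hdet, one_mul]
  have h3 := congrFun (congrFun h2 i) j
  rw [Matrix.mul_apply, Matrix.diagonal_mul] at h3
  exact h3

/-- The sum of the moduli of all entries of the given vectors. -/
noncomputable def vectorBound (u : Fin 2 → Fin 2 → ℂ) : ℝ := ∑ k, ∑ i, ‖u i k‖

theorem vectorBound_nonneg (u : Fin 2 → Fin 2 → ℂ) : 0 ≤ vectorBound u := by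
  unfold vectorBound; positivity

theorem norm_sub_le_vectorBound_mul (hu : LinearIndependent ℂ u) (a x : Fin 2 → ℝ) :
    ‖x - a‖ ≤ vectorBound u * ‖eigenCoord u a x‖ := by
  have hv := vectorBound_nonneg u
  refine (pi_norm_le_iff_of_nonneg (by positivity)).2 fun k => ?_
  have h1 : (Matrix.of fun k i => u i k : Matrix (Fin 2) (Fin 2) ℂ).mulVec (eigenCoord u a x)
      = fun k => ((x k - a k : ℝ) : ℂ) := by
    rw [eigenCoord, Matrix.mulVec_mulVec,
      Matrix.mul_nonsing_inv _ (isUnit_det_of_linearIndependent hu), Matrix.one_mulVec]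
  have h2 : ((x k - a k : ℝ) : ℂ) = ∑ i, u i k * eigenCoord u a x i := (congrFun h1 k).symm
  have h3 : ‖x k - a k‖ = ‖∑ i, u i k * eigenCoord u a x i‖ := by
    rw [← h2, Complex.norm_real]
  rw [Pi.sub_apply, h3]
  calc _ ≤ ∑ i, ‖u i k * eigenCoord u a x i‖ := norm_sum_le _ _
    _ ≤ ∑ i, ‖u i k‖ * ‖eigenCoord u a x‖ := by
        refine Finset.sum_le_sum fun i _ => ?_
        rw [norm_mul]
        exact mul_le_mul_of_nonneg_left (norm_le_pi_norm _ i) (norm_nonneg _)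
    _ = (∑ i, ‖u i k‖) * ‖eigenCoord u a x‖ := by rw [Finset.sum_mul]
    _ ≤ _ := by
        refine mul_le_mul_of_nonneg_right ?_ (norm_nonneg _)
        exact Finset.single_le_sum (f := fun k => ∑ i, ‖u i k‖) (fun k _ => by positivity)
          (Finset.mem_univ k)

theorem norm_sum_coordMatrix_mul_le (u : Fin 2 → Fin 2 → ℂ) (i : Fin 2) {d : Fin 2 → ℝ} {s : ℝ}
    (hd : ∀ k, |d k| ≤ s) : ‖∑ k, coordMatrix u i k * (d k : ℂ)‖ ≤ 2 * coordBound u * s := by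
  have hb := coordBound_nonneg u
  calc _ ≤ ∑ k, ‖coordMatrix u i k * (d k : ℂ)‖ := norm_sum_le _ _
    _ ≤ ∑ _k : Fin 2, coordBound u * s := by
        refine Finset.sum_le_sum fun k _ => ?_
        rw [norm_mul, Complex.norm_real, Real.norm_eq_abs]
        exact mul_le_mul (norm_coordMatrix_le u i k) (hd k) (abs_nonneg _) hb
    _ = _ := by simp; ring

theorem exists_norm_eigenCoord_sub_le (hu : LinearIndependent ℂ u) {H : (Fin 2 → ℝ) → Fin 2 → ℝ}
    (hH : ∀ i, DifferentiableAt ℝ (fun x => H x i) a) (ha : H a = a)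
    (heig : ∀ i, ((jacobian H a).map (fun x : ℝ => (x : ℂ))).mulVec (u i) = lam i • u i)
    {δ : ℝ} (hδ : 0 < δ) :
    ∃ ε > 0, ∀ x, ‖eigenCoord u a x‖ ≤ ε → ∀ i,
      ‖eigenCoord u a (H x) i - lam i * eigenCoord u a x i‖ ≤ δ * ‖eigenCoord u a x‖ := by
  have hv := vectorBound_nonneg u
  have hb := coordBound_nonneg u
  -- Passing from β to α and back costs the factor `2 * coordBound u * vectorBound u`; the `+ 1`
  -- keeps the denominator positive.
  set δ' : ℝ := δ / (2 * coordBound u * vectorBound u + 1) with hδ'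
  obtain ⟨ε, hε, h⟩ := exists_abs_sub_sum_jacobian_le hH (show 0 < δ' by positivity)
  refine ⟨ε / (vectorBound u + 1), by positivity, fun x hx i => ?_⟩
  have hxa := norm_sub_le_vectorBound_mul hu a x
  have hxε : ‖x - a‖ < ε := by
    rw [le_div_iff₀ (by positivity)] at hx
    have := norm_nonneg (eigenCoord u a x)
    rcases this.eq_or_lt with h0 | h0
    · rw [← h0, mul_zero] at hxa
      exact hxa.trans_lt hε
    · nlinarith
  have e : eigenCoord u a (H x) i - lam i * eigenCoord u a x i
      = ∑ k, coordMatrix u i k *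
        ((H x k - H a k - ∑ j, jacobian H a k j * (x j - a j) : ℝ) : ℂ) := by
    have h0 := sum_coordMatrix_mul hu heig i 0
    have h1 := sum_coordMatrix_mul hu heig i 1
    rw [eigenCoord_apply, eigenCoord_apply, ha]
    simp only [Fin.sum_univ_two, Matrix.map_apply] at h0 h1 ⊢
    push_cast
    linear_combination (-(x 0 : ℂ) + a 0) * h0 * (-1) + (-(x 1 : ℂ) + a 1) * h1 * (-1)
  rw [e]
  refine (norm_sum_coordMatrix_mul_le u i (h x hxε)).trans ?_
  calc 2 * coordBound u * (δ' * ‖x - a‖)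
      ≤ 2 * coordBound u * (δ' * (vectorBound u * ‖eigenCoord u a x‖)) := by gcongr
    _ = δ' * (2 * coordBound u * vectorBound u) * ‖eigenCoord u a x‖ := by ring
    _ ≤ δ' * (2 * coordBound u * vectorBound u + 1) * ‖eigenCoord u a x‖ := by
        gcongr
        linarith
    _ = _ := by rw [hδ']; field_simp

end Linearization

/-! ### Conditional means on good graphs. -/

section Mean

variable {n : ℕ} {f₁ f₂ : ℝ[X]} {p q C₁ C₂ : ℝ} {G : SimpleGraph (Vertex n)}
  {u : Fin 2 → Fin 2 → ℂ} {a : Fin 2 → ℝ} {lam : Fin 2 → ℂ}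

theorem card_part_compl (A : Finset (Vertex n)) (k : Fin 2) :
    ((part Aᶜ k).card : ℝ) = n - (part A k).card := by
  have h : (part A k).card + (part Aᶜ k).card = n := by
    rw [part, part, ← Finset.card_union_of_disjoint, ← Finset.filter_union, Finset.union_compl]
    · have : (Finset.univ.filter fun v : Vertex n => v.1 = k)
          = Finset.univ.map ⟨fun j : Fin n => (k, j), fun _ _ h => (Prod.mk.inj h).2⟩ := by
        ext ⟨i, j⟩
        simp only [Finset.mem_filter, Finset.mem_univ, true_and, Finset.mem_map]
        exact ⟨fun h => ⟨j, Prod.ext h.symm rfl⟩, fun ⟨_, h⟩ => (Prod.mk.inj h).1.symm⟩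
      rw [this, Finset.card_map, Finset.card_univ, Fintype.card_fin]
    · exact Finset.disjoint_filter_filter disjoint_compl_right
  rw [eq_sub_iff_add_eq', ← Nat.cast_add, h]

theorem mul_stepExp_density (hn : 0 < n) (A : Finset (Vertex n)) (k : Fin 2) :
    n * stepExp f₁ f₂ G A (fun B => density B k)
      = ∑ v ∈ part A k, f₁.eval (ratio G A v) + ∑ v ∈ part Aᶜ k, f₂.eval (ratio G A v) := by
  have hn' : (n : ℝ) ≠ 0 := by positivity
  rw [stepExp_density, part, part, Finset.sum_filter, Finset.sum_filter, Finset.mul_sum,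
    ← Finset.sum_add_sum_compl A]
  congr 1
  · refine Finset.sum_congr rfl fun v hv => ?_
    rw [vertexProb, if_pos hv]
    split_ifs
    · field_simp
    · simp
  · refine Finset.sum_congr rfl fun v hv => ?_
    rw [vertexProb, if_neg (Finset.mem_compl.1 hv)]
    split_ifs
    · field_simp
    · simp

theorem meanRatio_eq (hp : 0 < p) (hq : 0 ≤ q) (hn : 0 < n) (A : Finset (Vertex n)) (k : Fin 2) :
    meanRatio p q A k = (density A k + q / p * density A k.rev) / (1 + q / p) := by
  have hn' : (n : ℝ) ≠ 0 := by positivity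
  have hpq : p + q ≠ 0 := by positivity
  rw [meanRatio, density, density]
  field_simp

/-- Goodness is used for `f₁` on `A` and for `f₂` on its complement. Each costs `C₁ √(n/p)`, and
division by `n` leaves order 1/√n. -/
theorem abs_stepExp_density_sub_le (hp : 0 < p) (hq : 0 ≤ q) (hn : 0 < n)
    (h₁ : IsGood (fun x => f₁.eval x) p q C₁ C₂ G) (h₂ : IsGood (fun x => f₂.eval x) p q C₁ C₂ G)
    (A : Finset (Vertex n)) (k : Fin 2) :
    |stepExp f₁ f₂ G A (fun B => density B k) - inducedMap f₁ f₂ (q / p) (density A) k|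
      ≤ 2 * |C₁| / √p / √n := by
  have hn' : (0 : ℝ) < n := by exact_mod_cast hn
  have g1 := h₁.abs_sub_le A A k
  have g2 := h₂.abs_sub_le A Aᶜ k
  rw [card_part_compl] at g2
  have hm := mul_stepExp_density (f₁ := f₁) (f₂ := f₂) (G := G) hn A k
  set m := stepExp f₁ f₂ G A (fun B => density B k) with hmdef
  have hH : n * inducedMap f₁ f₂ (q / p) (density A) k
      = (part A k).card * f₁.eval (meanRatio p q A k)
        + (n - (part A k).card) * f₂.eval (meanRatio p q A k) := by
    rw [inducedMap, ← meanRatio_eq hp hq hn, density]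
    field_simp
  have h3 : n * |m - inducedMap f₁ f₂ (q / p) (density A) k| ≤ 2 * (|C₁| * √(n / p)) := by
    rw [← abs_of_pos hn', ← abs_mul, abs_of_pos hn', mul_sub, hm, hH]
    have h4 : C₁ * √((n : ℝ) / p) ≤ |C₁| * √(n / p) :=
      mul_le_mul_of_nonneg_right (le_abs_self _) (Real.sqrt_nonneg _)
    rw [abs_le] at g1 g2 ⊢
    constructor <;> linarith [g1.1, g1.2, g2.1, g2.2]
  have hsn : 0 < √(n : ℝ) := Real.sqrt_pos.2 hn'
  have hsp : 0 < √p := Real.sqrt_pos.2 hp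
  rw [Real.sqrt_div hn'.le] at h3
  rw [div_div, le_div_iff₀ (by positivity)]
  have h5 : n * |m - inducedMap f₁ f₂ (q / p) (density A) k|
      = √n * (√n * |m - inducedMap f₁ f₂ (q / p) (density A) k|) := by
    rw [← mul_assoc, Real.mul_self_sqrt hn'.le]
  rw [h5] at h3
  have h6 : √n * |m - inducedMap f₁ f₂ (q / p) (density A) k| ≤ 2 * |C₁| / √p := by
    refine le_of_mul_le_mul_left (h3.trans (le_of_eq ?_)) hsn
    ring
  rw [le_div_iff₀ hsp] at h6
  linarith

/-- `C` comes from the graph alone and is fixed before `δ`; only the radius depends on `δ`. This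
order matters, as the admissible coupling is itself determined by `C`. -/
theorem exists_norm_stepExp_beta_sub_le (hp : 0 < p) (hq : 0 ≤ q)
    (ha : inducedMap f₁ f₂ (q / p) a = a)
    (heig : ∀ i, ((jacobian (inducedMap f₁ f₂ (q / p)) a).map
      (fun x : ℝ => (x : ℂ))).mulVec (u i) = lam i • u i)
    (hu : LinearIndependent ℂ u) (C₁ C₂ : ℝ) :
    ∃ C : ℝ, 0 ≤ C ∧ ∀ δ > 0, ∃ ε > 0, ∀ n > 0, ∀ G : SimpleGraph (Vertex n),
      IsGood (fun x => f₁.eval x) p q C₁ C₂ G → IsGood (fun x => f₂.eval x) p q C₁ C₂ G →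
      ∀ A : Finset (Vertex n), ‖beta u a A‖ ≤ ε → ∀ i,
        ‖stepExp f₁ f₂ G A (fun B => beta u a B i) - lam i * beta u a A i‖
          ≤ δ * ‖beta u a A‖ + C / √n := by
  have hb := coordBound_nonneg u
  refine ⟨2 * coordBound u * (2 * |C₁| / √p), by positivity, fun δ hδ => ?_⟩
  obtain ⟨ε, hε, h⟩ := exists_norm_eigenCoord_sub_le hu
    (fun i => (differentiable_inducedMap_apply f₁ f₂ (q / p) i) a) ha heig hδ
  refine ⟨ε, hε, fun n hn G h₁ h₂ A hA i => ?_⟩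
  have e : stepExp f₁ f₂ G A (fun B => beta u a B i) - lam i * beta u a A i
      = (eigenCoord u a (inducedMap f₁ f₂ (q / p) (density A)) i - lam i * beta u a A i)
        + ∑ k, coordMatrix u i k * ((stepExp f₁ f₂ G A (fun B => density B k)
          - inducedMap f₁ f₂ (q / p) (density A) k : ℝ) : ℂ) := by
    rw [stepExp_beta, eigenCoord_apply, eigenCoord_apply]
    simp only [Fin.sum_univ_two]
    push_cast
    ring
  rw [e]
  refine (norm_add_le _ _).trans (add_le_add (h _ hA i) ?_)
  refine (norm_sum_coordMatrix_mul_le u i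
    (abs_stepExp_density_sub_le hp hq hn h₁ h₂ A)).trans (le_of_eq ?_)
  ring

-- Chebyshev's inequality for the fluctuation of `β'`.
open Classical in
theorem one_sub_le_stepPr (hf₁ : ∀ x ∈ Set.Icc (0 : ℝ) 1, f₁.eval x ∈ Set.Icc (0 : ℝ) 1)
    (hf₂ : ∀ x ∈ Set.Icc (0 : ℝ) 1, f₂.eval x ∈ Set.Icc (0 : ℝ) 1) (hn : 0 < n)
    {A : Finset (Vertex n)} {P : Finset (Vertex n) → Prop} {s : ℝ} (hs : 0 < s)
    (hP : ∀ B, fluctuation f₁ f₂ G u a A B ≤ s → P B) :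
    1 - 4 * coordBound u ^ 2 / (n * s ^ 2) ≤ stepPr f₁ f₂ G A P := by
  have hn' : (0 : ℝ) < n := by exact_mod_cast hn
  have h0 : ∀ B, 0 ≤ stepProb f₁ f₂ G A B :=
    bernoulliWeight_nonneg (vertexProb_mem_Icc hf₁ hf₂ A)
  have h1 := sum_stepProb_mul_fluctuation_sq_le (G := G) (u := u) (a := a) hf₁ hf₂ hn A
  have h2 : (1 - stepPr f₁ f₂ G A P) * (n * s ^ 2) ≤ 4 * coordBound u ^ 2 := by
    refine le_trans ?_ h1
    rw [stepPr, ← sum_stepProb (f₁ := f₁) (f₂ := f₂) (G := G) A, ← Finset.sum_sub_distrib,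
      Finset.sum_mul]
    refine Finset.sum_le_sum fun B _ => ?_
    split_ifs with hB
    · rw [sub_self, zero_mul]
      exact mul_nonneg (h0 B) (sq_nonneg _)
    · rw [sub_zero, mul_pow, Real.sq_sqrt hn'.le]
      have h3 : s ≤ fluctuation f₁ f₂ G u a A B := (not_le.1 fun h => hB (hP B h)).le
      have := h0 B
      gcongr
  have h4 : 1 - stepPr f₁ f₂ G A P ≤ 4 * coordBound u ^ 2 / (n * s ^ 2) :=
    (le_div_iff₀ (by positivity)).2 h2
  linarith

end Mean

/-! ### The three choices of expanding and contracting quantities. -/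

section Cases

variable {f₁ f₂ : ℝ[X]} {p q C₁ C₂ ε₀ c₀ : ℝ} {u : Fin 2 → Fin 2 → ℂ} {a : Fin 2 → ℝ}
  {lam : Fin 2 → ℂ}

theorem norm_stepExp_beta_sub_fluctuation_le {n : ℕ} {G : SimpleGraph (Vertex n)}
    (A B : Finset (Vertex n)) (i : Fin 2) :
    ‖stepExp f₁ f₂ G A fun B => beta u a B i‖ - fluctuation f₁ f₂ G u a A B
      ≤ ‖beta u a B i‖ := by
  have h1 := norm_beta_sub_stepExp_le (f₁ := f₁) (f₂ := f₂) (G := G) (u := u) (a := a) A B i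
  have h2 := norm_sub_norm_le (stepExp f₁ f₂ G A fun B => beta u a B i) (beta u a B i)
  rw [norm_sub_rev] at h1
  linarith

theorem norm_beta_le_norm_stepExp_add_fluctuation {n : ℕ} {G : SimpleGraph (Vertex n)}
    (A B : Finset (Vertex n)) (i : Fin 2) :
    ‖beta u a B i‖
      ≤ ‖stepExp f₁ f₂ G A fun B => beta u a B i‖ + fluctuation f₁ f₂ G u a A B := by
  have h1 := norm_beta_sub_stepExp_le (f₁ := f₁) (f₂ := f₂) (G := G) (u := u) (a := a) A B i
  have h2 := norm_sub_norm_le (beta u a B i) (stepExp f₁ f₂ G A fun B => beta u a B i)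
  linarith

/-- The assumed drift of `|β_i|` involves no other coordinate, so `υ = 0` and the contraction
condition is trivial. The rate is capped at 2 because the potential argument asks for `l ≤ 2`. -/
theorem escapesWhp_of_expandingDrift
    (hf₁ : ∀ x ∈ Set.Icc (0 : ℝ) 1, f₁.eval x ∈ Set.Icc (0 : ℝ) 1)
    (hf₂ : ∀ x ∈ Set.Icc (0 : ℝ) 1, f₂.eval x ∈ Set.Icc (0 : ℝ) 1)
    (hu : LinearIndependent ℂ u) (hlam : ∃ i, 1 < ‖lam i‖) (hc₀ : 0 < c₀)
    {εs ε₁ C c : ℝ} (hεs : 0 < εs) (hε₁ : 0 < ε₁) (hC : 0 < C) (hc : 0 < c)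
    (hball : ∀ x ∈ Set.Icc (0 : Fin 2 → ℝ) 1, ‖eigenCoord u a x‖ ≤ εs → x ∈ Metric.ball a ε₀) :
    EscapesWhp.{w} f₁ f₂ a u lam fun _ => {G | VarianceLowerBound f₁ f₂ a ε₀ c₀ G ∧
      ExpandingDrift f₁ f₂ a u lam εs ε₁ C G ∧ NonexpandingStable f₁ f₂ a u lam εs c G} := by
  obtain ⟨i, hi⟩ := hlam
  obtain ⟨δ, hδ, h⟩ := escapesWhp_of_hasEscapeDrift (lam := lam) hf₁ hf₂ hu a i
    (l := min 2 (1 + ε₁)) (ρ := 0) (lt_min one_lt_two (by linarith)) (min_le_left _ _)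
    one_pos hC.le hc₀
  refine h _ εs c (fun β => ‖β i‖) (fun _ => 0) hεs hc (fun _ => le_rfl)
    (fun β => norm_le_pi_norm β i) (fun _ => le_rfl) (fun β => norm_nonneg β)
    ⟨1, fun n _ G ⟨hvar, hexp, hst⟩ => ⟨fun A hA => ?_, fun A hA B => ?_, fun A _ B => ?_,
      fun A hA j hj => ?_⟩⟩
  · exact hvar A (hball _ (density_mem_Icc A) hA)
  · have h1 := hexp A hA i hi
    have h2 := norm_stepExp_beta_sub_fluctuation_le (f₁ := f₁) (f₂ := f₂) (G := G) (u := u)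
      (a := a) A B i
    have h3 : min 2 (1 + ε₁) * ‖beta u a A i‖ ≤ (1 + ε₁) * ‖beta u a A i‖ :=
      mul_le_mul_of_nonneg_right (min_le_right _ _) (norm_nonneg _)
    linarith
  · have := fluctuation_nonneg (f₁ := f₁) (f₂ := f₂) (G := G) (u := u) (a := a) A B
    positivity
  · exact hst j hj A ((norm_le_pi_norm _ j).trans hA)

theorem exists_stepVar_ge (hu : LinearIndependent ℂ u) (a : Fin 2 → ℝ) (hε₀ : 0 < ε₀) :
    ∃ ε > 0, ∀ (n : ℕ) (G : SimpleGraph (Vertex n)), VarianceLowerBound f₁ f₂ a ε₀ c₀ G →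
      ∀ A : Finset (Vertex n), ‖beta u a A‖ ≤ ε → ∀ k,
        c₀ / n ≤ stepVar f₁ f₂ G A fun B => density B k := by
  have hv := vectorBound_nonneg u
  refine ⟨ε₀ / (2 * (vectorBound u + 1)), by positivity, fun n G hG A hA => hG A ?_⟩
  rw [mem_ball_iff_norm]
  calc ‖density A - a‖ ≤ vectorBound u * ‖beta u a A‖ := norm_sub_le_vectorBound_mul hu a _
    _ ≤ (vectorBound u + 1) * (ε₀ / (2 * (vectorBound u + 1))) := by gcongr; linarith
    _ = ε₀ / 2 := by field_simp
    _ < ε₀ := by linarith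

/-- A single small coordinate may be swamped by the nonlinear coupling to the other, but the largest
one expands; hence `ξ = ‖β‖`. No coordinate is nonexpanding, so the stability exponent is arbitrary.
-/
theorem escapesWhp_of_forall_one_lt_norm (hp : 0 < p) (hq : 0 ≤ q)
    (hf₁ : ∀ x ∈ Set.Icc (0 : ℝ) 1, f₁.eval x ∈ Set.Icc (0 : ℝ) 1)
    (hf₂ : ∀ x ∈ Set.Icc (0 : ℝ) 1, f₂.eval x ∈ Set.Icc (0 : ℝ) 1)
    (ha : inducedMap f₁ f₂ (q / p) a = a)
    (heig : ∀ i, ((jacobian (inducedMap f₁ f₂ (q / p)) a).map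
      (fun x : ℝ => (x : ℂ))).mulVec (u i) = lam i • u i)
    (hu : LinearIndependent ℂ u) (hlam : ∀ i, 1 < ‖lam i‖) (hε₀ : 0 < ε₀) (hc₀ : 0 < c₀) :
    EscapesWhp.{w} f₁ f₂ a u lam fun _ => {G |
      IsGood (fun x => f₁.eval x) p q C₁ C₂ G ∧ IsGood (fun x => f₂.eval x) p q C₁ C₂ G ∧
      VarianceLowerBound f₁ f₂ a ε₀ c₀ G} := by
  obtain ⟨C, hC, hlin⟩ := exists_norm_stepExp_beta_sub_le hp hq ha heig hu C₁ C₂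
  obtain ⟨ε₂, hε₂, hvar⟩ := exists_stepVar_ge (f₁ := f₁) (f₂ := f₂) (c₀ := c₀) hu a hε₀
  obtain ⟨l, hl, hl'⟩ : ∃ l, 1 < l ∧ ∀ i, l ≤ ‖lam i‖ :=
    ⟨min ‖lam 0‖ ‖lam 1‖, lt_min (hlam 0) (hlam 1), fun i => by
      fin_cases i
      exacts [min_le_left _ _, min_le_right _ _]⟩
  obtain ⟨δ, hδ, h⟩ := escapesWhp_of_hasEscapeDrift (lam := lam) hf₁ hf₂ hu a 0
    (l := min 2 ((1 + l) / 2)) (ρ := 0) (lt_min one_lt_two (by linarith)) (min_le_left _ _)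
    one_pos hC hc₀
  -- Half of the gap `l - 1` is spent on the nonlinear error, which leaves the rate `(1 + l) / 2`.
  obtain ⟨ε₁, hε₁, hlin⟩ := hlin ((l - 1) / 2) (by linarith)
  refine h _ (min ε₁ ε₂) 1 (fun β => ‖β‖) (fun _ => 0) (lt_min hε₁ hε₂) one_pos
    (fun β => norm_le_pi_norm β 0) (fun _ => le_rfl) (fun _ => le_rfl) (fun β => norm_nonneg β)
    ⟨1, fun n hn G ⟨hg₁, hg₂, hv⟩ => ⟨fun A hA => ?_, fun A hA B => ?_, fun A _ B => ?_,
      fun A hA j hj => absurd hj (not_le.2 (hlam j))⟩⟩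
  · exact hvar n G hv A (hA.trans (min_le_right _ _))
  · obtain ⟨i, hi⟩ : ∃ i, ‖beta u a A‖ ≤ ‖beta u a A i‖ := by
      obtain ⟨i, -, hi⟩ := Finset.exists_max_image Finset.univ (fun i => ‖beta u a A i‖)
        ⟨0, Finset.mem_univ _⟩
      exact ⟨i, (pi_norm_le_iff_of_nonneg (norm_nonneg _)).2 fun j => hi j (Finset.mem_univ j)⟩
    have h1 := hlin n hn G hg₁ hg₂ A (hA.trans (min_le_left _ _)) i
    have h2 := norm_stepExp_beta_sub_fluctuation_le (f₁ := f₁) (f₂ := f₂) (G := G) (u := u)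
      (a := a) A B i
    have h3 := norm_sub_norm_le (lam i * beta u a A i) (stepExp f₁ f₂ G A fun B => beta u a B i)
    rw [norm_sub_rev, norm_mul] at h3
    have h4 : l * ‖beta u a A‖ ≤ ‖lam i‖ * ‖beta u a A i‖ :=
      mul_le_mul (hl' i) hi (norm_nonneg _) (norm_nonneg _)
    have h5 : min 2 ((1 + l) / 2) * ‖beta u a A‖ ≤ (1 + l) / 2 * ‖beta u a A‖ :=
      mul_le_mul_of_nonneg_right (min_le_right _ _) (norm_nonneg _)
    have h6 := norm_le_pi_norm (beta u a B) i
    linarith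
  · have := fluctuation_nonneg (f₁ := f₁) (f₂ := f₂) (G := G) (u := u) (a := a) A B
    positivity

theorem exists_nat_div_sqrt_le_and (C Q : ℝ) {g : ℝ} (hg : 0 < g) :
    ∃ N : ℕ, ∀ n ≥ N, 0 < n ∧ C / √(n : ℝ) ≤ g ∧ Q / (n * g ^ 2) ≤ (n : ℝ) ^ (-(1 / 2 : ℝ)) := by
  have ht : Filter.Tendsto (fun n : ℕ => √(n : ℝ)) Filter.atTop Filter.atTop :=
    Real.tendsto_sqrt_atTop.comp tendsto_natCast_atTop_atTop
  obtain ⟨N, hN⟩ := Filter.eventually_atTop.1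
    ((ht.eventually_ge_atTop (C / g)).and (ht.eventually_ge_atTop (Q / g ^ 2)))
  refine ⟨max N 1, fun n hn => ?_⟩
  obtain ⟨h1, h2⟩ := hN n ((le_max_left _ _).trans hn)
  have hn0 : 0 < n := (le_max_right _ _).trans hn
  have hn' : (0 : ℝ) < n := by exact_mod_cast hn0
  have hs : 0 < √(n : ℝ) := Real.sqrt_pos.2 hn'
  refine ⟨hn0, ?_, ?_⟩
  · rw [div_le_iff₀ hg] at h1
    rw [div_le_iff₀ hs]
    linarith
  · rw [div_le_iff₀ (by positivity)] at h2
    rw [Real.rpow_neg hn'.le, ← Real.sqrt_eq_rpow, div_le_iff₀ (by positivity)]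
    have : (√(n : ℝ))⁻¹ * (n * g ^ 2) = √n * g ^ 2 := by
      nth_rewrite 2 [← Real.mul_self_sqrt hn'.le]
      field_simp
    rw [this]
    exact h2

/-- Both spectral gaps are halved to absorb the diagonal part of the linearization error; the
off-diagonal part is the coupling. Strict contraction of `β_j` also yields stability: its mean stays
inside the ball with a margin proportional to `ε`. -/
theorem escapesWhp_of_saddle (hp : 0 < p) (hq : 0 ≤ q)
    (hf₁ : ∀ x ∈ Set.Icc (0 : ℝ) 1, f₁.eval x ∈ Set.Icc (0 : ℝ) 1)
    (hf₂ : ∀ x ∈ Set.Icc (0 : ℝ) 1, f₂.eval x ∈ Set.Icc (0 : ℝ) 1)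
    (ha : inducedMap f₁ f₂ (q / p) a = a)
    (heig : ∀ i, ((jacobian (inducedMap f₁ f₂ (q / p)) a).map
      (fun x : ℝ => (x : ℂ))).mulVec (u i) = lam i • u i)
    (hu : LinearIndependent ℂ u) {i j : Fin 2} (hi : 1 < ‖lam i‖) (hj : ‖lam j‖ < 1)
    (hε₀ : 0 < ε₀) (hc₀ : 0 < c₀) :
    EscapesWhp.{w} f₁ f₂ a u lam fun _ => {G |
      IsGood (fun x => f₁.eval x) p q C₁ C₂ G ∧ IsGood (fun x => f₂.eval x) p q C₁ C₂ G ∧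
      VarianceLowerBound f₁ f₂ a ε₀ c₀ G} := by
  have hij : ∀ k, k = i ∨ k = j := by
    have : i ≠ j := by rintro rfl; linarith
    omega
  have hnorm : ∀ β : Fin 2 → ℂ, ‖β‖ ≤ ‖β i‖ + ‖β j‖ := by
    intro β
    refine (pi_norm_le_iff_of_nonneg (by positivity)).2 fun k => ?_
    rcases hij k with rfl | rfl
    · linarith [norm_nonneg (β j)]
    · linarith [norm_nonneg (β i)]
  obtain ⟨C, hC, hlin⟩ := exists_norm_stepExp_beta_sub_le hp hq ha heig hu C₁ C₂
  obtain ⟨ε₂, hε₂, hvar⟩ := exists_stepVar_ge (f₁ := f₁) (f₂ := f₂) (c₀ := c₀) hu a hε₀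
  set ρ : ℝ := (1 + ‖lam j‖) / 2 with hρ
  have hρ1 : ρ < 1 := by rw [hρ]; linarith
  obtain ⟨δ, hδ, h⟩ := escapesWhp_of_hasEscapeDrift (lam := lam) hf₁ hf₂ hu a i
    (l := min 2 ((1 + ‖lam i‖) / 2)) (ρ := ρ) (lt_min one_lt_two (by linarith)) (min_le_left _ _)
    hρ1 hC hc₀
  obtain ⟨δ', hδ'0, hδ'δ, hδ'i, hδ'j⟩ : ∃ δ' : ℝ, 0 < δ' ∧ δ' ≤ δ ∧ δ' ≤ (‖lam i‖ - 1) / 2 ∧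
      δ' ≤ (1 - ‖lam j‖) / 2 :=
    ⟨min δ (min ((‖lam i‖ - 1) / 2) ((1 - ‖lam j‖) / 2)),
      lt_min hδ (lt_min (by linarith) (by linarith)), min_le_left _ _,
      (min_le_right _ _).trans (min_le_left _ _), (min_le_right _ _).trans (min_le_right _ _)⟩
  obtain ⟨ε₁, hε₁, hlin⟩ := hlin δ' hδ'0
  set ε : ℝ := min ε₁ ε₂ with hε
  have hε0 : 0 < ε := lt_min hε₁ hε₂
  -- The conditional mean of `β'_j` has modulus at most `ρ ε + C/√n`. The margin `(1 - ρ) ε` is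
  -- shared equally by `C/√n` and the fluctuation; Chebyshev's O(1/n) is then relaxed to `n^{-1/2}`
  -- to absorb its constant.
  have hg : 0 < (1 - ρ) * ε / 2 := half_pos (mul_pos (by linarith) hε0)
  obtain ⟨N, hN⟩ := exists_nat_div_sqrt_le_and C (4 * coordBound u ^ 2) hg
  refine h _ ε (1 / 2) (fun β => ‖β i‖) (fun β => ‖β j‖) hε0 (by norm_num) (fun _ => le_rfl)
    (fun β => norm_le_pi_norm β i) (fun β => norm_nonneg _) (fun β => norm_le_pi_norm β j)
    ⟨N, fun n hn G ⟨hg₁, hg₂, hv⟩ => ⟨fun A hA => ?_, fun A hA B => ?_, fun A hA B => ?_,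
      fun A hA k hk => ?_⟩⟩
  · exact hvar n G hv A (hA.trans (min_le_right _ _))
  · obtain ⟨hn0, -, -⟩ := hN n hn
    have h1 := hlin n hn0 G hg₁ hg₂ A (hA.trans (min_le_left _ _)) i
    have h2 := norm_stepExp_beta_sub_fluctuation_le (f₁ := f₁) (f₂ := f₂) (G := G) (u := u)
      (a := a) A B i
    have h3 := norm_sub_norm_le (lam i * beta u a A i) (stepExp f₁ f₂ G A fun B => beta u a B i)
    rw [norm_sub_rev, norm_mul] at h3
    have h4 : min 2 ((1 + ‖lam i‖) / 2) * ‖beta u a A i‖ ≤ (1 + ‖lam i‖) / 2 * ‖beta u a A i‖ :=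
      mul_le_mul_of_nonneg_right (min_le_right _ _) (norm_nonneg _)
    have h5 : δ' * ‖beta u a A‖ ≤ δ' * (‖beta u a A i‖ + ‖beta u a A j‖) :=
      mul_le_mul_of_nonneg_left (hnorm _) hδ'0.le
    have h6 := mul_le_mul_of_nonneg_right hδ'i (norm_nonneg (beta u a A i))
    have h7 := mul_le_mul_of_nonneg_right hδ'δ (norm_nonneg (beta u a A j))
    linarith
  · obtain ⟨hn0, -, -⟩ := hN n hn
    have h1 := hlin n hn0 G hg₁ hg₂ A (hA.trans (min_le_left _ _)) j
    have h2 := norm_beta_le_norm_stepExp_add_fluctuation (f₁ := f₁) (f₂ := f₂) (G := G) (u := u)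
      (a := a) A B j
    have h3 := norm_sub_norm_le (stepExp f₁ f₂ G A fun B => beta u a B j) (lam j * beta u a A j)
    rw [norm_mul] at h3
    have h5 : δ' * ‖beta u a A‖ ≤ δ' * (‖beta u a A i‖ + ‖beta u a A j‖) :=
      mul_le_mul_of_nonneg_left (hnorm _) hδ'0.le
    have h6 := mul_le_mul_of_nonneg_right hδ'δ (norm_nonneg (beta u a A i))
    have h7 := mul_le_mul_of_nonneg_right hδ'j (norm_nonneg (beta u a A j))
    rw [hρ]
    linarith
  · obtain ⟨hn0, hCn, hQn⟩ := hN n hn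
    obtain rfl : k = j := (hij k).resolve_left (by rintro rfl; linarith)
    have h1 := hlin n hn0 G hg₁ hg₂ A (hA.trans (min_le_left _ _)) k
    refine le_trans ?_ (one_sub_le_stepPr (u := u) (a := a) hf₁ hf₂ hn0 hg fun B hB => ?_)
    · linarith
    · have h2 := norm_beta_le_norm_stepExp_add_fluctuation (f₁ := f₁) (f₂ := f₂) (G := G) (u := u)
        (a := a) A B k
      have h3 := norm_sub_norm_le (stepExp f₁ f₂ G A fun B => beta u a B k) (lam k * beta u a A k)
      rw [norm_mul] at h3
      have h4 : ‖lam k‖ * ‖beta u a A k‖ ≤ ‖lam k‖ * ε :=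
        mul_le_mul_of_nonneg_left ((norm_le_pi_norm _ k).trans hA) (norm_nonneg _)
      have h5 : δ' * ‖beta u a A‖ ≤ (1 - ‖lam k‖) / 2 * ε :=
        mul_le_mul hδ'j hA (norm_nonneg _) (by linarith)
      rw [hρ] at hB hCn
      linarith

theorem EscapesWhp.mono {𝒢 𝒢' : ∀ n : ℕ, Set (SimpleGraph (Vertex n))}
    (h : EscapesWhp.{w} f₁ f₂ a u lam 𝒢) (h𝒢 : ∀ n, 𝒢' n ⊆ 𝒢 n) :
    EscapesWhp.{w} f₁ f₂ a u lam 𝒢' := by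
  obtain ⟨ε, hε, K, hK, c, hc, N, hN⟩ := h
  exact ⟨ε, hε, K, hK, c, hc, N, fun n hn G hG => hN n hn G (h𝒢 n hG)⟩

end Cases

end Voting

theorem proposition7p8
    (p q : ℝ) (hp : 0 < p) (hp1 : p ≤ 1) (hq : 0 ≤ q) (hqp : q ≤ p)
    (f₁ f₂ : Polynomial ℝ)
    (hf₁ : ∀ x ∈ Set.Icc (0 : ℝ) 1, f₁.eval x ∈ Set.Icc (0 : ℝ) 1)
    (hf₂ : ∀ x ∈ Set.Icc (0 : ℝ) 1, f₂.eval x ∈ Set.Icc (0 : ℝ) 1)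
    (a : Fin 2 → ℝ) (ha : Voting.inducedMap f₁ f₂ (q / p) a = a)
    (u : Fin 2 → Fin 2 → ℂ) (lam : Fin 2 → ℂ)
    (heig : ∀ i, ((Voting.jacobian (Voting.inducedMap f₁ f₂ (q / p)) a).map
      (fun x : ℝ => (x : ℂ))).mulVec (u i) = lam i • u i)
    (hu : LinearIndependent ℂ u)
    (hlam : ∃ i, 1 < ‖lam i‖)
    (C₁ C₂ ε₀ c₀ : ℝ) (hε₀ : 0 < ε₀) (hc₀ : 0 < c₀) :
    (∀ εs ε₁ C c : ℝ, 0 < εs → 0 < ε₁ → 0 < C → 0 < c →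
      (∀ x ∈ Set.Icc (0 : Fin 2 → ℝ) 1, ‖Voting.eigenCoord u a x‖ ≤ εs → x ∈ Metric.ball a ε₀) →
      Voting.EscapesWhp.{w} f₁ f₂ a u lam fun _ => {G |
        Voting.IsGood (fun x => f₁.eval x) p q C₁ C₂ G ∧
        Voting.IsGood (fun x => f₂.eval x) p q C₁ C₂ G ∧
        Voting.VarianceLowerBound f₁ f₂ a ε₀ c₀ G ∧
        Voting.ExpandingDrift f₁ f₂ a u lam εs ε₁ C G ∧
        Voting.NonexpandingStable f₁ f₂ a u lam εs c G}) ∧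
    ((∀ i, ‖lam i‖ ≠ 1) →
      Voting.EscapesWhp.{w} f₁ f₂ a u lam fun _ => {G |
        Voting.IsGood (fun x => f₁.eval x) p q C₁ C₂ G ∧
        Voting.IsGood (fun x => f₂.eval x) p q C₁ C₂ G ∧
        Voting.VarianceLowerBound f₁ f₂ a ε₀ c₀ G}) := by
  refine ⟨fun εs ε₁ C c hεs hε₁ hC hc hball => ?_, fun hne => ?_⟩
  · exact (Voting.escapesWhp_of_expandingDrift hf₁ hf₂ hu hlam hc₀ hεs hε₁ hC hc hball).mono
      fun n G hG => hG.2.2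
  · by_cases hall : ∀ i, 1 < ‖lam i‖
    · exact Voting.escapesWhp_of_forall_one_lt_norm hp hq hf₁ hf₂ ha heig hu hall hε₀ hc₀
    · push Not at hall
      obtain ⟨i, hi⟩ := hlam
      obtain ⟨j, hj⟩ := hall
      exact Voting.escapesWhp_of_saddle hp hq hf₁ hf₂ ha heig hu hi (hj.lt_of_ne (hne j)) hε₀ hc₀
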